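/- All semirings are commutative. A semiring $M$ is bipotent if $a+b\in\{a,b\}$ for all $a,b\in M$, ordered by $a\le b \Leftrightarrow a+b=b$; it is cancellative if $ab=ac$, $a\neq 0$ imply $b=c$. A valuation $v:R\to M$ on a semiring $R$ is a multiplicative map to a cancellative bipotent semiring $M$ with $v(0)=0$, $v(1)=1$, $v(a+b)\le v(a)+v(b)$. A semiring $U$ is supertropical if $e:=1+1$ is idempotent, $x+y\in\{x,y\}$ whenever $ex\ne ey$, and $x+y=ex$ whenever $ex=ey$; then $eU$ is bipotent, and $\mathcal T(U):=U\setminus eU$ is the set of tangible elements. A transmission $U\to V$ between supertropical semirings is a multiplicative map sending $0,1,e$ to $0,1,e$ and additive on $eU$. A (surjective) supervaluation covering $v$ is a multiplicative map $\varphi:R\to U$ with $\varphi(0)=0$, $\varphi(1)=1$, where $U$ is a supertropical semiring with $eU=M$, $e\varphi=v$ and $U=\varphi(R)\cup e\varphi(R)$; it is tangible if $\varphi(R)\subset\mathcal T(U)\cup\{0\}$. (If $v$ is a valuation and $\varphi$ is tangible, $\mathcal T(U)$ is automatically closed under multiplication.) Write $\varphi\ge\psi$ if $\psi=\alpha\circ\varphi$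 for some transmission $\alpha$, call $\varphi,\psi$ equivalent if $\varphi\ge\psi\ge\varphi$, and let $\mathrm{Cov}_t(v)$ be the poset of equivalence classes of tangible supervaluations covering $v$. Let $\gamma:M\to N$ be a surjective semiring homomorphism to a cancellative bipotent semiring $N$, and $\mathfrak p:=\gamma^{-1}(0)$. For a supertropical semiring $U$ with $eU=M$, let $\alpha_{U,\gamma}:U\to U_\gamma=U/E(U,\gamma)$ be the initial transmission covering $\gamma$; here $x\sim_{E(U,\gamma)} y$ iff $x=y$, or $x,y\in M$ and $\gamma(x)=\gamma(y)$, or $ex,ey\in\mathfrak p$. The pushout of $\varphi:R\to U$ along $\gamma$ is $\gamma_*(\varphi):=\alpha_{U,\gamma}\circ\varphi:R\to U_\gamma$. It covers $\gamma v$, and this gives a map $\gamma_{*,t}:\mathrm{Cov}_t(v)\to\mathrm{Cov}_t(\gamma v)$. The t-collapse of a tangible $\varphi:R\to U$ over $\mathfrak p$ is the composite of $\varphi$ with the quotient homomorphism of $U$ by the congruence for which distinct $x,y$ are equivalent iff $x,y\in\mathcal T(U)$ and $ex=ey\in\mathfrak p$; this gives a map $\mathrm{Cov}_t(v)\to\mathrm{Cov}_t(v)$,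 whose image, the set of tangible supervaluations t-collapsed over $\mathfrak p$, is denoted by $\mathrm{Cov}_{t,\mathfrak p}(v)$. **Theorem 2.14.** Let $v:R\to M$ be a surjective valuation and $\gamma:M\to N$ a surjective homomorphism to a cancellative bipotent semiring. (a) The pushout map $\gamma_{*,t}:\mathrm{Cov}_t(v)\to\mathrm{Cov}_t(\gamma v)$ restricts to a bijection from $\mathrm{Cov}_{t,\mathfrak p}(v)$ onto $\gamma_*(\mathrm{Cov}_t(v))$. The posets $\mathrm{Cov}_t(v)$ and $\mathrm{Cov}_t(\gamma v)$ are lattices, $\mathrm{Cov}_{t,\mathfrak p}(v)$ is a sublattice of the first and $\gamma_*(\mathrm{Cov}_t(v))$ is a sublattice of the second, and the bijection is an isomorphism between these lattices. (b) If $\varphi,\psi\in\mathrm{Cov}_t(v)$, then $\gamma_*(\varphi)=\gamma_*(\psi)$ iff $\varphi$ and $\psi$ have the same t-collapse over $\mathfrak p$. -/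

import Mathlib

universe u

/-! ### Bipotent semirings and m-valuations -/

/-- A commutative semiring is bipotent if every sum is one of its two summands. -/
class IsBipotent (M : Type*) [CommSemiring M] : Prop where
  add_eq_or : ∀ a b : M, a + b = a ∨ a + b = b

/-- The natural order of a bipotent semiring (for which `a + b = max a b`):
`x ≤ y` iff `x + y = y`. -/
def AddLE {M : Type*} [Add M] (x y : M) : Prop := x + y = y

/-- An m-valuation on `R` with values in `M` (which is bipotent in all uses): a multiplicative map
preserving `0` and `1` with `v (a + b) ≤ v a + v b`. It is a valuation if `M` is cancellative. -/
structure MValuation (R M : Type*) [CommSemiring R] [CommSemiring M] extends R →*₀ M where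
  map_add_le' : ∀ a b, AddLE (toFun (a + b)) (toFun a + toFun b)

instance {R M : Type*} [CommSemiring R] [CommSemiring M] :
    CoeFun (MValuation R M) (fun _ => R → M) := ⟨fun v => v.toFun⟩

/-- The coarsening `γ ∘ v` of an m-valuation along a semiring homomorphism. -/
def MValuation.coarsen {R M N : Type*} [CommSemiring R] [CommSemiring M] [CommSemiring N]
    (v : MValuation R M) (γ : M →+* N) : MValuation R N where
  toMonoidWithZeroHom := γ.toMonoidWithZeroHom.comp v.toMonoidWithZeroHom
  map_add_le' a b := by
    have h := congrArg γ (v.map_add_le' a b)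
    simp only [map_add] at h
    exact h

/-! ### Supertropical semirings, transmissions, supervaluations -/

/-- The element `e = 1 + 1` of a semiring. -/
def ghostUnit (U : Type*) [CommSemiring U] : U := 1 + 1

/-- Supertropical semirings. -/
class IsSupertropical (U : Type*) [CommSemiring U] : Prop where
  idem : ghostUnit U * ghostUnit U = ghostUnit U
  add_eq_or : ∀ x y : U, ghostUnit U * x ≠ ghostUnit U * y → x + y = x ∨ x + y = y
  add_eq_ghost : ∀ x y : U, ghostUnit U * x = ghostUnit U * y → x + y = ghostUnit U * x

/-- The ghost ideal `eU`. -/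
def ghostIdeal (U : Type*) [CommSemiring U] : Ideal U := Ideal.span {ghostUnit U}

/-- The set `𝒯(U) = U ∖ eU` of tangible elements. -/
def tangibles (U : Type*) [CommSemiring U] : Set U := {x | x ∉ ghostIdeal U}

/-- The set of tangible elements is closed under multiplication. -/
def TangiblesClosed (U : Type*) [CommSemiring U] : Prop :=
  ∀ x ∈ tangibles U, ∀ y ∈ tangibles U, x * y ∈ tangibles U

/-- A transmission `U → V`: a multiplicative map preserving `0`, `1` and `e` whose restriction
to `eU` is additive (so that it is a semiring homomorphism `eU → eV`). -/
@[ext]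
structure Transmission (U V : Type*) [CommSemiring U] [CommSemiring V] extends U →*₀ V where
  map_ghostUnit' : toFun (ghostUnit U) = ghostUnit V
  map_add_ghost' : ∀ x ∈ ghostIdeal U, ∀ y ∈ ghostIdeal U, toFun (x + y) = toFun x + toFun y

instance {U V : Type*} [CommSemiring U] [CommSemiring V] :
    CoeFun (Transmission U V) (fun _ => U → V) := ⟨fun α => α.toFun⟩

/-- A supervaluation `R → U` (with `U` supertropical in all uses). -/
structure Supervaluation (R U : Type*) [CommSemiring R] [CommSemiring U] extends R →*₀ U where
  map_add_le' : ∀ a b, AddLE (ghostUnit U * toFun (a + b))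
    (ghostUnit U * toFun a + ghostUnit U * toFun b)

instance {R U : Type*} [CommSemiring R] [CommSemiring U] :
    CoeFun (Supervaluation R U) (fun _ => R → U) := ⟨fun φ => φ.toFun⟩

/-- An identification of the semiring `M` with the ghost ideal `eU` (whose unit is `e`). -/
structure GhostIdent (M U : Type*) [CommSemiring M] [CommSemiring U] extends M →ₙ+* U where
  map_one' : toFun 1 = ghostUnit U
  injective' : Function.Injective toFun
  range' : Set.range toFun = (ghostIdeal U : Set U)

instance {M U : Type*} [CommSemiring M] [CommSemiring U] :
    CoeFun (GhostIdent M U) (fun _ => M → U) := ⟨fun ι => ι.toFun⟩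

section Basics

variable {U V : Type*} [CommSemiring U] [IsSupertropical U] [CommSemiring V] [IsSupertropical V]
variable {M N : Type*} [CommSemiring M] [CommSemiring N]

theorem ghostUnit_mul_self_mul (x : U) :
    ghostUnit U * (ghostUnit U * x) = ghostUnit U * x := by
  rw [← mul_assoc, IsSupertropical.idem]

theorem mem_ghostIdeal_iff {x : U} : x ∈ ghostIdeal U ↔ ghostUnit U * x = x := by
  unfold ghostIdeal
  rw [Ideal.mem_span_singleton']
  constructor
  · rintro ⟨a, rfl⟩
    rw [mul_comm a, ghostUnit_mul_self_mul]
  · intro h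
    exact ⟨x, by rw [mul_comm, h]⟩

theorem ghostUnit_mul_mem (x : U) : ghostUnit U * x ∈ ghostIdeal U :=
  mem_ghostIdeal_iff.2 (ghostUnit_mul_self_mul x)

theorem eq_zero_of_ghostUnit_mul {x : U} (h : ghostUnit U * x = 0) : x = 0 := by
  have := IsSupertropical.add_eq_ghost x 0 (by rw [h, mul_zero])
  rwa [add_zero, h] at this

theorem GhostIdent.map_mul (ι : GhostIdent M U) (a b : M) : ι (a * b) = ι a * ι b :=
  ι.map_mul' a b

theorem GhostIdent.map_add (ι : GhostIdent M U) (a b : M) : ι (a + b) = ι a + ι b :=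
  ι.map_add' a b

theorem GhostIdent.map_zero (ι : GhostIdent M U) : ι 0 = 0 := ι.map_zero'

theorem GhostIdent.map_one (ι : GhostIdent M U) : ι 1 = ghostUnit U := ι.map_one'

theorem GhostIdent.mem (ι : GhostIdent M U) (m : M) : ι m ∈ ghostIdeal U := by
  have : ι m ∈ Set.range ι.toFun := ⟨m, rfl⟩
  rw [ι.range'] at this
  exact this

theorem GhostIdent.e_mul (ι : GhostIdent M U) (m : M) : ghostUnit U * ι m = ι m :=
  mem_ghostIdeal_iff.1 (ι.mem m)

theorem GhostIdent.exists_of_mem (ι : GhostIdent M U) {x : U} (hx : x ∈ ghostIdeal U) :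
    ∃ m, ι m = x := by
  have : x ∈ (ghostIdeal U : Set U) := hx
  rw [← ι.range'] at this
  exact this

/-- The ghost map `x ↦ e x`, as a map to `M` (identified with `eU`). -/
noncomputable def GhostIdent.nu (ι : GhostIdent M U) (x : U) : M :=
  (ι.exists_of_mem (ghostUnit_mul_mem x)).choose

theorem GhostIdent.apply_nu (ι : GhostIdent M U) (x : U) : ι (ι.nu x) = ghostUnit U * x :=
  (ι.exists_of_mem (ghostUnit_mul_mem x)).choose_spec

theorem GhostIdent.nu_apply (ι : GhostIdent M U) (m : M) : ι.nu (ι m) = m :=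
  ι.injective' (by rw [ι.apply_nu]; exact ι.e_mul m)

theorem GhostIdent.nu_eq_iff (ι : GhostIdent M U) (x y : U) :
    ι.nu x = ι.nu y ↔ ghostUnit U * x = ghostUnit U * y := by
  rw [← ι.apply_nu, ← ι.apply_nu]
  exact ⟨fun h => by rw [h], fun h => ι.injective' h⟩

theorem GhostIdent.nu_mul (ι : GhostIdent M U) (x y : U) : ι.nu (x * y) = ι.nu x * ι.nu y := by
  apply ι.injective'
  rw [ι.map_mul, ι.apply_nu, ι.apply_nu, ι.apply_nu]
  calc ghostUnit U * (x * y) = (ghostUnit U * ghostUnit U) * (x * y) := by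
        rw [IsSupertropical.idem]
    _ = _ := by ring

theorem GhostIdent.nu_one (ι : GhostIdent M U) : ι.nu 1 = 1 := by
  apply ι.injective'
  rw [ι.apply_nu, mul_one, ι.map_one]

theorem GhostIdent.nu_zero (ι : GhostIdent M U) : ι.nu 0 = 0 := by
  rw [← ι.map_zero, ι.nu_apply]

theorem GhostIdent.eq_zero_of_nu (ι : GhostIdent M U) {x : U} (h : ι.nu x = 0) : x = 0 :=
  eq_zero_of_ghostUnit_mul (by rw [← ι.apply_nu, h, ι.map_zero])

theorem GhostIdent.ghost_mul (ι : GhostIdent M U) (m : M) (x : U) :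
    ι m * x = ι (m * ι.nu x) := by
  rw [ι.map_mul, ι.apply_nu, ← mul_assoc, mul_comm _ (ghostUnit U), ι.e_mul]

/-- A multiplicative map preserving `0`, `1` and covering a semiring homomorphism of the ghost
ideals is a transmission. -/
def Transmission.ofCovers (ι : GhostIdent M U) (κ : GhostIdent N V) (γ : M →+* N) (f : U →*₀ V)
    (h : ∀ m, f (ι m) = κ (γ m)) : Transmission U V where
  toMonoidWithZeroHom := f
  map_ghostUnit' := by
    change f _ = _
    rw [← ι.map_one, h, _root_.map_one γ, κ.map_one]
  map_add_ghost' x hx y hy := by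
    obtain ⟨m, rfl⟩ := ι.exists_of_mem hx
    obtain ⟨n, rfl⟩ := ι.exists_of_mem hy
    change f (ι m + ι n) = f (ι m) + f (ι n)
    rw [← ι.map_add, h, h, h, _root_.map_add γ, κ.map_add]

end Basics

/-! ### Supervaluations covering a given m-valuation -/

/-- A surjective supervaluation `φ : R → U` covering `v : R → M`, where `U` is a supertropical
semiring with ghost ideal `M`. As `U = φ(R) ∪ e φ(R)`, up to isomorphism all targets live in the
universe of `R`. -/
structure SVCover {R : Type u} {M : Type*} [CommSemiring R] [CommSemiring M]
    (v : MValuation R M) where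
  carrier : Type u
  [semiring : CommSemiring carrier]
  [supertropical : IsSupertropical carrier]
  toSV : Supervaluation R carrier
  ghost : GhostIdent M carrier
  covers : ∀ a, ghost (v a) = ghostUnit carrier * toSV a
  surj : ∀ x : carrier, (∃ a, x = toSV a) ∨ (∃ a, x = ghostUnit carrier * toSV a)

attribute [instance] SVCover.semiring SVCover.supertropical

namespace SVCover

variable {R : Type u} {M N : Type*} [CommSemiring R] [CommSemiring M] [CommSemiring N]
variable {v : MValuation R M}

/-- Dominance: `ψ ≤ φ` iff `ψ = α ∘ φ` for a transmission `α`. -/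
instance : Preorder (SVCover v) where
  le ψ φ := ∃ α : Transmission φ.carrier ψ.carrier, ∀ a, ψ.toSV a = α (φ.toSV a)
  le_refl φ := ⟨⟨MonoidWithZeroHom.id _, rfl, fun _ _ _ _ => rfl⟩, fun _ => rfl⟩
  le_trans ψ φ χ := by
    rintro ⟨α, hα⟩ ⟨β, hβ⟩
    refine ⟨⟨α.toMonoidWithZeroHom.comp β.toMonoidWithZeroHom, ?_, ?_⟩, ?_⟩
    · change α (β _) = _
      rw [β.map_ghostUnit', α.map_ghostUnit']
    · intro x hx y hy
      have key : ∀ z ∈ ghostIdeal χ.carrier, β z ∈ ghostIdeal φ.carrier := by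
        intro z hz
        rw [mem_ghostIdeal_iff] at hz ⊢
        have := β.map_mul' (ghostUnit _) z
        change β _ = β _ * β _ at this
        rw [hz, β.map_ghostUnit'] at this
        exact this.symm
      change α (β (x + y)) = α (β x) + α (β y)
      rw [← α.map_add_ghost' _ (key x hx) _ (key y hy), β.map_add_ghost' x hx y hy]
    · intro a
      change _ = α (β _)
      rw [hα, hβ]

/-- A supervaluation is tangible if all its values are tangible or zero. -/
def IsTangible (φ : SVCover v) : Prop :=
  ∀ a, φ.toSV a ∈ tangibles φ.carrier ∨ φ.toSV a = 0

theorem nu_toSV (φ : SVCover v) (a : R) : φ.ghost.nu (φ.toSV a) = v a := by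
  apply φ.ghost.injective'
  rw [φ.ghost.apply_nu, φ.covers]

theorem exists_of_tangible (φ : SVCover v) {x : φ.carrier} (hx : x ∈ tangibles φ.carrier) :
    ∃ a, x = φ.toSV a := by
  rcases φ.surj x with h | ⟨a, rfl⟩
  · exact h
  · exact absurd (ghostUnit_mul_mem _) hx

/-- If `M` is cancellative, the tangibles are automatically closed under multiplication in the
target of a (surjective) tangible supervaluation. -/
theorem IsTangible.tangiblesClosed [IsCancelMulZero M] {φ : SVCover v} (h : φ.IsTangible) :
    TangiblesClosed φ.carrier := by
  intro x hx y hy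
  obtain ⟨a, rfl⟩ := φ.exists_of_tangible hx
  obtain ⟨b, rfl⟩ := φ.exists_of_tangible hy
  have hab : φ.toSV a * φ.toSV b = φ.toSV (a * b) := (φ.toSV.map_mul' a b).symm
  rcases h (a * b) with h1 | h1
  · rw [hab]; exact h1
  · have h2 : φ.ghost.nu (φ.toSV a) * φ.ghost.nu (φ.toSV b) = 0 := by
      rw [← φ.ghost.nu_mul, hab, h1, φ.ghost.nu_zero]
    rcases mul_eq_zero.1 h2 with h3 | h3
    · exact absurd (by rw [φ.ghost.eq_zero_of_nu h3]; exact Ideal.zero_mem _) hx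
    · exact absurd (by rw [φ.ghost.eq_zero_of_nu h3]; exact Ideal.zero_mem _) hy

/-- A transmission between covers of `v` is the identity on `M`. -/
theorem transmission_ghost {φ ψ : SVCover v} (α : Transmission φ.carrier ψ.carrier)
    (h : ∀ a, ψ.toSV a = α (φ.toSV a)) (m : M) : α (φ.ghost m) = ψ.ghost m := by
  obtain ⟨a, ha⟩ : ∃ a, φ.ghost m = ghostUnit _ * φ.toSV a := by
    rcases φ.surj (φ.ghost m) with ⟨a, ha⟩ | ⟨a, ha⟩
    · exact ⟨a, by rw [← ha, φ.ghost.e_mul]⟩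
    · exact ⟨a, ha⟩
  have hm : m = v a := φ.ghost.injective' (by rw [φ.covers a]; exact ha)
  rw [ha, hm, ψ.covers, h]
  have := α.map_mul' (ghostUnit _) (φ.toSV a)
  rw [α.map_ghostUnit'] at this
  exact this

end SVCover

/-- The tangible (surjective) supervaluations covering `v`. -/
def TangibleSVCover {R : Type u} {M : Type*} [CommSemiring R] [CommSemiring M]
    (v : MValuation R M) := {φ : SVCover v // φ.IsTangible}

instance {R : Type u} {M : Type*} [CommSemiring R] [CommSemiring M] (v : MValuation R M) :
    Preorder (TangibleSVCover v) := inferInstanceAs (Preorder {φ : SVCover v // φ.IsTangible})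

/-- The poset `Cov_t(v)` of equivalence classes of tangible supervaluations covering `v`, ordered by
dominance; two supervaluations are equivalent iff each dominates the other. -/
abbrev TCov {R : Type u} {M : Type*} [CommSemiring R] [CommSemiring M] (v : MValuation R M) :=
  Antisymmetrization (TangibleSVCover v) (· ≤ ·)

/-! ### The semiring structure determined by a ghost map

The addition of a supertropical semiring is determined by multiplication, the ghost map and
the order of the ghosts. Conversely this rule defines a supertropical semiring if the ghosts
are cancellative. -/

section OfGhostMap

variable {X N : Type*} [CommMonoid X] [CommSemiring N] [IsBipotent N]

/-- `x + y` is `e x`, `y` or `x` according to `e x = e y`, `e x < e y` or `e x > e y`. -/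
noncomputable def ghostAdd (ν : X →* N) (ι : N → X) (x y : X) : X :=
  open Classical in
  if ν x = ν y then ι (ν x) else if ν x + ν y = ν y then y else x

theorem nu_ghostAdd (ν : X →* N) (ι : N → X) (h1 : ∀ n, ν (ι n) = n) (x y : X) :
    ν (ghostAdd ν ι x y) = ν x + ν y := by
  unfold ghostAdd
  have := IsBipotent.add_eq_or (ν x) (ν y)
  split_ifs with h h'
  · rw [h1]; rcases this with h2 | h2 <;> simp_all
  · exact h'.symm
  · tauto

theorem ghostAdd_comm (ν : X →* N) (ι : N → X) (x y : X) :
    ghostAdd ν ι x y = ghostAdd ν ι y x := by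
  unfold ghostAdd
  have := IsBipotent.add_eq_or (ν x) (ν y)
  have := add_comm (ν x) (ν y)
  grind

theorem ghostAdd_assoc (ν : X →* N) (ι : N → X) (h1 : ∀ n, ν (ι n) = n) (x y z : X) :
    ghostAdd ν ι (ghostAdd ν ι x y) z = ghostAdd ν ι x (ghostAdd ν ι y z) := by
  have e1 := nu_ghostAdd ν ι h1 x y
  have e2 := nu_ghostAdd ν ι h1 y z
  have a1 := IsBipotent.add_eq_or (ν x) (ν y)
  have a2 := IsBipotent.add_eq_or (ν y) (ν z)
  have a3 := IsBipotent.add_eq_or (ν x) (ν z)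
  have a4 := add_assoc (ν x) (ν y) (ν z)
  have a5 := IsBipotent.add_eq_or (ν y) (ν y)
  have c1 := add_comm (ν x) (ν y)
  have c2 := add_comm (ν y) (ν z)
  have c3 := add_comm (ν x) (ν z)
  unfold ghostAdd at *
  grind

/-- The semiring structure given by `ghostAdd`. -/
@[reducible]
noncomputable def semiringOfGhostMap [IsCancelMulZero N] (ν : X →* N) (ι : N → X)
    (h1 : ∀ n, ν (ι n) = n) (h2 : ∀ n x, ι n * x = ι (n * ν x)) (h3 : ∀ x, ν x = 0 → x = ι 0) :
    CommSemiring X :=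
  have zadd : ∀ x, ghostAdd ν ι (ι 0) x = x := by
    intro x
    unfold ghostAdd
    rw [h1, zero_add, if_pos rfl]
    split_ifs with h
    · exact (h3 x h.symm).symm
    · rfl
  have ldist : ∀ x y z, x * ghostAdd ν ι y z = ghostAdd ν ι (x * y) (x * z) := by
    intro x y z
    by_cases hx : ν x = 0
    · rw [h3 x hx, h2, zero_mul, h2, h2, zero_mul, zero_mul, zadd]
    · unfold ghostAdd
      rw [map_mul, map_mul, ← mul_add]
      have k : ∀ a b, ν x * a = ν x * b ↔ a = b :=
        fun a b => ⟨fun h => mul_left_cancel₀ hx h, fun h => by rw [h]⟩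
      by_cases c1 : ν y = ν z
      · rw [if_pos c1, if_pos ((k _ _).2 c1), mul_comm, h2, mul_comm]
      · rw [if_neg c1, if_neg (fun h => c1 ((k _ _).1 h))]
        by_cases c2 : ν y + ν z = ν z
        · rw [if_pos c2, if_pos ((k _ _).2 c2)]
        · rw [if_neg c2, if_neg (fun h => c2 ((k _ _).1 h))]
  { (inferInstance : CommMonoid X) with
    zero := ι 0
    add := ghostAdd ν ι
    add_assoc := ghostAdd_assoc ν ι h1
    add_comm := ghostAdd_comm ν ι
    zero_add := zadd
    add_zero := fun x => (ghostAdd_comm ν ι _ _).trans (zadd x)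
    nsmul := @nsmulRec X ⟨ι 0⟩ ⟨ghostAdd ν ι⟩
    left_distrib := ldist
    right_distrib := fun x y z => by
      change ghostAdd ν ι x y * z = ghostAdd ν ι (x * z) (y * z)
      rw [mul_comm, ldist, mul_comm z, mul_comm z]
    zero_mul := fun x => by
      change ι 0 * x = ι 0
      rw [h2, zero_mul]
    mul_zero := fun x => by
      change x * ι 0 = ι 0
      rw [mul_comm, h2, zero_mul] }

end OfGhostMap

/-! ### The pushout along `γ` -/

section Pushout

variable {M N U : Type*} [CommSemiring M] [CommSemiring N] [CommSemiring U] [IsSupertropical U]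

/-- The multiplicative equivalence relation `E(U, γ)` on `U`: `x ∼ y` iff `x = y`, or both are ghost
with `γ x = γ y`, or `γ (e x) = γ (e y) = 0`. -/
def pushoutCon (ι : GhostIdent M U) (γ : M →+* N) : Con U where
  r x y := x = y ∨ (∃ m n, x = ι m ∧ y = ι n ∧ γ m = γ n) ∨
    (γ (ι.nu x) = 0 ∧ γ (ι.nu y) = 0)
  iseqv := by
    refine ⟨fun x => Or.inl rfl, ?_, ?_⟩
    · rintro x y (rfl | ⟨m, n, rfl, rfl, h⟩ | ⟨h, h'⟩)
      · exact Or.inl rfl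
      · exact Or.inr (Or.inl ⟨n, m, rfl, rfl, h.symm⟩)
      · exact Or.inr (Or.inr ⟨h', h⟩)
    · rintro x y z (rfl | ⟨m, n, rfl, rfl, h⟩ | ⟨h, h'⟩) hyz
      · exact hyz
      · rcases hyz with rfl | ⟨m', n', h1, rfl, h2⟩ | ⟨h1, h2⟩
        · exact Or.inr (Or.inl ⟨m, n, rfl, rfl, h⟩)
        · obtain rfl := ι.injective' h1
          exact Or.inr (Or.inl ⟨m, n', rfl, rfl, h.trans h2⟩)
        · refine Or.inr (Or.inr ⟨?_, h2⟩)
          rw [ι.nu_apply] at h1 ⊢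
          rw [h, h1]
      · rcases hyz with rfl | ⟨m', n', rfl, rfl, h2⟩ | ⟨h1, h2⟩
        · exact Or.inr (Or.inr ⟨h, h'⟩)
        · refine Or.inr (Or.inr ⟨h, ?_⟩)
          rw [ι.nu_apply] at h' ⊢
          rw [← h2, h']
        · exact Or.inr (Or.inr ⟨h, h2⟩)
  mul' := by
    have key : ∀ {x y : U} (z : U), (x = y ∨ (∃ m n, x = ι m ∧ y = ι n ∧ γ m = γ n) ∨
        (γ (ι.nu x) = 0 ∧ γ (ι.nu y) = 0)) → (x = y ∧ x * z = y * z) ∨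
        ((∃ m n, x * z = ι m ∧ y * z = ι n ∧ γ m = γ n)) ∨
        (γ (ι.nu (x * z)) = 0 ∧ γ (ι.nu (y * z)) = 0) := by
      rintro x y z (rfl | ⟨m, n, rfl, rfl, h⟩ | ⟨h, h'⟩)
      · exact Or.inl ⟨rfl, rfl⟩
      · exact Or.inr (Or.inl ⟨_, _, ι.ghost_mul m z, ι.ghost_mul n z, by rw [map_mul, map_mul, h]⟩)
      · exact Or.inr (Or.inr ⟨by rw [ι.nu_mul, map_mul, h, zero_mul],
          by rw [ι.nu_mul, map_mul, h', zero_mul]⟩)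
    rintro w x y z h1 h2
    rcases h1 with rfl | ⟨m, n, rfl, rfl, h⟩ | ⟨h, h'⟩
    · rw [mul_comm w y, mul_comm w z]
      rcases key w h2 with ⟨-, h⟩ | h
      · exact Or.inl h
      · exact Or.inr h
    · rw [ι.ghost_mul, ι.ghost_mul]
      refine Or.inr (Or.inl ⟨_, _, rfl, rfl, ?_⟩)
      rw [map_mul, map_mul, h]
      rcases h2 with rfl | ⟨m', n', rfl, rfl, h2⟩ | ⟨h1, h2⟩
      · rfl
      · rw [ι.nu_apply, ι.nu_apply, h2]
      · rw [h1, h2]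
    · exact Or.inr (Or.inr ⟨by rw [ι.nu_mul, map_mul, h, zero_mul],
        by rw [ι.nu_mul, map_mul, h', zero_mul]⟩)

/-- The monoid `U_γ = U / E(U, γ)`. -/
abbrev PushoutCarrier (ι : GhostIdent M U) (γ : M →+* N) := (pushoutCon ι γ).Quotient

/-- The ghost map of `U_γ`, with values in `N`. -/
noncomputable def pushoutNu (ι : GhostIdent M U) (γ : M →+* N) : PushoutCarrier ι γ →* N :=
  (pushoutCon ι γ).lift
    { toFun := fun x => γ (ι.nu x)
      map_one' := by rw [ι.nu_one, map_one]
      map_mul' := fun x y => by rw [ι.nu_mul, map_mul] }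
    (by
      rintro x y (rfl | ⟨m, n, rfl, rfl, h⟩ | ⟨h, h'⟩)
      · rfl
      · change γ (ι.nu (ι m)) = γ (ι.nu (ι n))
        rw [ι.nu_apply, ι.nu_apply, h]
      · exact h.trans h'.symm)

/-- The inclusion of `N` in `U_γ`, which sends `γ m` to the class of `m`. -/
noncomputable def pushoutIota (ι : GhostIdent M U) {γ : M →+* N} (hγ : Function.Surjective γ)
    (n : N) : PushoutCarrier ι γ := ((ι (Function.surjInv hγ n) : U) : PushoutCarrier ι γ)

theorem pushoutIota_map (ι : GhostIdent M U) {γ : M →+* N} (hγ : Function.Surjective γ) (m : M) :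
    pushoutIota ι hγ (γ m) = ((ι m : U) : PushoutCarrier ι γ) :=
  (Con.eq _).2 (Or.inr (Or.inl ⟨_, _, rfl, rfl, Function.surjInv_eq hγ _⟩))

theorem pushoutNu_coe (ι : GhostIdent M U) (γ : M →+* N) (x : U) :
    pushoutNu ι γ (x : PushoutCarrier ι γ) = γ (ι.nu x) := rfl

theorem pushoutNu_iota (ι : GhostIdent M U) {γ : M →+* N} (hγ : Function.Surjective γ) (n : N) :
    pushoutNu ι γ (pushoutIota ι hγ n) = n := by
  obtain ⟨m, rfl⟩ := hγ n
  rw [pushoutIota_map, pushoutNu_coe, ι.nu_apply]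

theorem pushoutIota_mul (ι : GhostIdent M U) {γ : M →+* N} (hγ : Function.Surjective γ) (n : N)
    (x : PushoutCarrier ι γ) :
    pushoutIota ι hγ n * x = pushoutIota ι hγ (n * pushoutNu ι γ x) := by
  obtain ⟨m, rfl⟩ := hγ n
  induction x using Con.induction_on with
  | H x =>
    rw [pushoutNu_coe, ← map_mul, pushoutIota_map, pushoutIota_map, ← Con.coe_mul, ι.ghost_mul]

theorem pushoutNu_eq_zero (ι : GhostIdent M U) {γ : M →+* N} (hγ : Function.Surjective γ)
    (x : PushoutCarrier ι γ) (h : pushoutNu ι γ x = 0) : x = pushoutIota ι hγ 0 := by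
  induction x using Con.induction_on with
  | H x =>
    rw [← map_zero γ, pushoutIota_map]
    refine (Con.eq _).2 (Or.inr (Or.inr ⟨h, ?_⟩))
    rw [ι.nu_apply, map_zero]

variable [IsBipotent N] [IsCancelMulZero N]

/-- The semiring structure of `U_γ`. -/
@[reducible]
noncomputable def pushoutSemiring (ι : GhostIdent M U) {γ : M →+* N}
    (hγ : Function.Surjective γ) : CommSemiring (PushoutCarrier ι γ) :=
  semiringOfGhostMap (pushoutNu ι γ) (pushoutIota ι hγ) (pushoutNu_iota ι hγ)
    (pushoutIota_mul ι hγ) (pushoutNu_eq_zero ι hγ)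

theorem pushout_ghostUnit (ι : GhostIdent M U) {γ : M →+* N} (hγ : Function.Surjective γ) :
    @ghostUnit _ (pushoutSemiring ι hγ) = pushoutIota ι hγ 1 := by
  change ghostAdd _ _ _ _ = _
  unfold ghostAdd
  rw [if_pos rfl, map_one]

theorem pushout_ghostUnit_mul (ι : GhostIdent M U) {γ : M →+* N} (hγ : Function.Surjective γ)
    (x : PushoutCarrier ι γ) :
    @ghostUnit _ (pushoutSemiring ι hγ) * x = pushoutIota ι hγ (pushoutNu ι γ x) := by
  rw [pushout_ghostUnit, pushoutIota_mul, one_mul]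

theorem pushoutIota_injective (ι : GhostIdent M U) {γ : M →+* N} (hγ : Function.Surjective γ) :
    Function.Injective (pushoutIota ι hγ) :=
  Function.LeftInverse.injective (pushoutNu_iota ι hγ)

theorem pushout_isSupertropical (ι : GhostIdent M U) {γ : M →+* N}
    (hγ : Function.Surjective γ) :
    @IsSupertropical (PushoutCarrier ι γ) (pushoutSemiring ι hγ) := by
  letI := pushoutSemiring ι hγ
  refine ⟨?_, ?_, ?_⟩
  · rw [pushout_ghostUnit_mul, pushout_ghostUnit, pushoutNu_iota]
  · intro x y h
    rw [pushout_ghostUnit_mul, pushout_ghostUnit_mul] at h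
    have h' : pushoutNu ι γ x ≠ pushoutNu ι γ y := fun h'' => h (by rw [h''])
    change ghostAdd _ _ _ _ = _ ∨ ghostAdd _ _ _ _ = _
    unfold ghostAdd
    rw [if_neg h']
    split_ifs
    · exact Or.inr rfl
    · exact Or.inl rfl
  · intro x y h
    rw [pushout_ghostUnit_mul, pushout_ghostUnit_mul] at h
    rw [pushout_ghostUnit_mul]
    change ghostAdd _ _ _ _ = _
    unfold ghostAdd
    rw [if_pos (pushoutIota_injective ι hγ h)]

/-- `N` is the ghost ideal of `U_γ`. -/
noncomputable def pushoutGhost (ι : GhostIdent M U) {γ : M →+* N}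
    (hγ : Function.Surjective γ) :
    letI := pushoutSemiring ι hγ
    GhostIdent N (PushoutCarrier ι γ) :=
  letI := pushoutSemiring ι hγ
  { toFun := pushoutIota ι hγ
    map_zero' := rfl
    map_mul' := fun a b => by rw [pushoutIota_mul, pushoutNu_iota]
    map_add' := fun a b => by
      change _ = ghostAdd _ _ _ _
      unfold ghostAdd
      rw [pushoutNu_iota, pushoutNu_iota]
      have := IsBipotent.add_eq_or a b
      split_ifs with h h'
      · rcases this with h1 | h1 <;> rw [h1]
        rw [h]
      · rw [h']
      · rw [this.resolve_right h']
    map_one' := (pushout_ghostUnit ι hγ).symm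
    injective' := pushoutIota_injective ι hγ
    range' := by
      haveI := pushout_isSupertropical ι hγ
      ext x
      rw [SetLike.mem_coe, mem_ghostIdeal_iff, pushout_ghostUnit_mul]
      constructor
      · rintro ⟨n, rfl⟩
        exact congrArg _ (pushoutNu_iota ι hγ n)
      · intro h
        exact ⟨_, h⟩ }

/-- The transmission `α_{U,γ} : U → U_γ`, `x ↦ [x]`. -/
noncomputable def pushoutTransmission (ι : GhostIdent M U) {γ : M →+* N}
    (hγ : Function.Surjective γ) :
    letI := pushoutSemiring ι hγ
    Transmission U (PushoutCarrier ι γ) :=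
  letI := pushoutSemiring ι hγ
  haveI := pushout_isSupertropical ι hγ
  Transmission.ofCovers ι (pushoutGhost ι hγ) γ
    { toFun := fun x => (x : PushoutCarrier ι γ)
      map_zero' := by
        rw [← ι.map_zero, ← pushoutIota_map ι hγ, map_zero]
        rfl
      map_one' := rfl
      map_mul' := fun _ _ => rfl }
    (fun m => (pushoutIota_map ι hγ m).symm)

/-- The map `α_{U,γ} : U → U_γ` has the defining property of the initial transmission covering
`γ`, and even that of the pushout transmission: every transmission `β : U → W` covering `δ ∘ γ`
factors uniquely through `α_{U,γ}` by a transmission covering `δ`. -/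
theorem pushoutTransmission_universal (ι : GhostIdent M U) {γ : M →+* N}
    (hγ : Function.Surjective γ) {L W : Type*} [CommSemiring L] [CommSemiring W]
    [IsSupertropical W] (κ : GhostIdent L W) (δ : N →+* L) (β : Transmission U W)
    (hβ : ∀ m, β (ι m) = κ (δ (γ m))) :
    letI := pushoutSemiring ι hγ
    ∃! η : Transmission (PushoutCarrier ι γ) W,
      (∀ n, η (pushoutGhost ι hγ n) = κ (δ n)) ∧
      ∀ x, β x = η (pushoutTransmission ι hγ x) := by
  letI := pushoutSemiring ι hγ
  haveI := pushout_isSupertropical ι hγ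
  have hz : ∀ x, γ (ι.nu x) = 0 → β x = 0 := by
    intro x hx
    apply eq_zero_of_ghostUnit_mul
    have h1 := hβ (ι.nu x)
    rw [hx, map_zero, κ.map_zero, ι.apply_nu] at h1
    have h2 := β.map_mul' (ghostUnit _) x
    rw [β.map_ghostUnit'] at h2
    exact h2.symm.trans h1
  let f : PushoutCarrier ι γ →* W := (pushoutCon ι γ).lift (β.toMonoidWithZeroHom : U →* W) (by
    rintro x y (rfl | ⟨m, n, rfl, rfl, h⟩ | ⟨h, h'⟩)
    · rfl
    · change β _ = β _
      rw [hβ, hβ, h]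
    · change β _ = β _
      rw [hz x h, hz y h'])
  have hf : ∀ n, f (pushoutGhost ι hγ n) = κ (δ n) := by
    intro n
    obtain ⟨m, rfl⟩ := hγ n
    change f (pushoutIota ι hγ (γ m)) = _
    rw [pushoutIota_map]
    exact hβ m
  let g : PushoutCarrier ι γ →*₀ W :=
    { toFun := f
      map_zero' := by
        have := hf 0
        rwa [map_zero, κ.map_zero, (pushoutGhost ι hγ).map_zero] at this
      map_one' := f.map_one
      map_mul' := f.map_mul }
  refine ⟨Transmission.ofCovers (pushoutGhost ι hγ) κ δ g hf, ⟨hf, fun x => rfl⟩, ?_⟩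
  rintro η ⟨-, h2⟩
  apply Transmission.ext
  ext x
  induction x using Con.induction_on with
  | H x => exact (h2 x).symm

end Pushout

section PushoutCover

variable {R : Type u} {M N : Type*} [CommSemiring R] [CommSemiring M] [CommSemiring N]
  [IsBipotent N] [IsCancelMulZero N] {v : MValuation R M}

/-- The pushout `γ_*(φ) = α_{U,γ} ∘ φ : R → U_γ` of `φ : R → U` along `γ`. -/
noncomputable def SVCover.pushout (φ : SVCover v) {γ : M →+* N} (hγ : Function.Surjective γ) :
    SVCover (v.coarsen γ) :=
  letI := pushoutSemiring φ.ghost hγ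
  haveI := pushout_isSupertropical φ.ghost hγ
  have hcov : ∀ a, pushoutGhost φ.ghost hγ (v.coarsen γ a) =
      ghostUnit _ * pushoutTransmission φ.ghost hγ (φ.toSV a) := fun a => by
    refine Eq.trans ?_ (pushout_ghostUnit_mul φ.ghost hγ _).symm
    change pushoutIota φ.ghost hγ (γ (v a)) = pushoutIota φ.ghost hγ (γ (φ.ghost.nu (φ.toSV a)))
    rw [φ.nu_toSV]
  { carrier := PushoutCarrier φ.ghost γ
    toSV :=
      { toMonoidWithZeroHom := (pushoutTransmission φ.ghost hγ).toMonoidWithZeroHom.comp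
          φ.toSV.toMonoidWithZeroHom
        map_add_le' := fun a b => by
          change AddLE (_ * pushoutTransmission φ.ghost hγ (φ.toSV (a + b)))
            (_ * pushoutTransmission φ.ghost hγ (φ.toSV a) +
              _ * pushoutTransmission φ.ghost hγ (φ.toSV b))
          rw [← hcov, ← hcov, ← hcov]
          unfold AddLE
          rw [← (pushoutGhost φ.ghost hγ).map_add, ← (pushoutGhost φ.ghost hγ).map_add]
          exact congrArg _ ((v.coarsen γ).map_add_le' a b) }
    ghost := pushoutGhost φ.ghost hγ
    covers := hcov
    surj := fun x => by
      induction x using Con.induction_on with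
      | H x =>
        rcases φ.surj x with ⟨a, rfl⟩ | ⟨a, rfl⟩
        · exact Or.inl ⟨a, rfl⟩
        · refine Or.inr ⟨a, Eq.trans ?_ (hcov a)⟩
          rw [← φ.covers]
          exact (pushoutIota_map φ.ghost hγ _).symm }

theorem SVCover.pushout_mono {φ ψ : SVCover v} {γ : M →+* N} (hγ : Function.Surjective γ)
    (h : ψ ≤ φ) : ψ.pushout hγ ≤ φ.pushout hγ := by
  obtain ⟨α, hα⟩ := h
  letI := pushoutSemiring φ.ghost hγ
  letI := pushoutSemiring ψ.ghost hγ
  haveI := pushout_isSupertropical φ.ghost hγ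
  haveI := pushout_isSupertropical ψ.ghost hγ
  let β : Transmission φ.carrier (PushoutCarrier ψ.ghost γ) :=
    Transmission.ofCovers φ.ghost (pushoutGhost ψ.ghost hγ) γ
      ((pushoutTransmission ψ.ghost hγ).toMonoidWithZeroHom.comp α.toMonoidWithZeroHom)
      (fun m => by
        change pushoutTransmission ψ.ghost hγ (α _) = pushoutIota ψ.ghost hγ _
        rw [SVCover.transmission_ghost α hα, pushoutIota_map]
        rfl)
  obtain ⟨η, ⟨-, hη⟩, -⟩ := pushoutTransmission_universal φ.ghost hγ (pushoutGhost ψ.ghost hγ)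
    (RingHom.id N) β (fun m => by
      change pushoutTransmission ψ.ghost hγ (α _) = pushoutIota ψ.ghost hγ _
      rw [SVCover.transmission_ghost α hα, RingHom.id_apply, pushoutIota_map]
      rfl)
  refine ⟨η, fun a => ?_⟩
  refine Eq.trans ?_ (hη (φ.toSV a))
  change pushoutTransmission ψ.ghost hγ (ψ.toSV a) = pushoutTransmission ψ.ghost hγ (α (φ.toSV a))
  rw [hα]

/-- The pushout of a tangible supervaluation is tangible. -/
theorem SVCover.IsTangible.pushout {φ : SVCover v} (h : φ.IsTangible) {γ : M →+* N}
    (hγ : Function.Surjective γ) : (φ.pushout hγ).IsTangible := by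
  letI := pushoutSemiring φ.ghost hγ
  haveI := pushout_isSupertropical φ.ghost hγ
  intro a
  by_cases h0 : γ (φ.ghost.nu (φ.toSV a)) = 0
  · exact Or.inr (pushoutNu_eq_zero φ.ghost hγ _ h0)
  · left
    intro hmem
    obtain ⟨n, hn⟩ := (pushoutGhost φ.ghost hγ).exists_of_mem hmem
    obtain ⟨m, rfl⟩ := hγ n
    have hn' : ((φ.ghost m : φ.carrier) : PushoutCarrier φ.ghost γ) = (φ.toSV a : φ.carrier) :=
      (pushoutIota_map φ.ghost hγ m).symm.trans hn
    have hne : φ.toSV a ∈ tangibles φ.carrier := by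
      refine (h a).resolve_right fun h1 => h0 ?_
      rw [h1, φ.ghost.nu_zero, map_zero]
    rcases (Con.eq _).1 hn' with h1 | ⟨m', n', -, h1, -⟩ | ⟨-, h1⟩
    · exact hne (h1 ▸ φ.ghost.mem m)
    · exact hne (h1 ▸ φ.ghost.mem n')
    · exact h0 h1

/-- The pushout map `γ_* : Cov_t(v) → Cov_t(γ v)`. -/
noncomputable def TCov.pushout (v : MValuation R M) {γ : M →+* N}
    (hγ : Function.Surjective γ) : TCov v → TCov (v.coarsen γ) :=
  Quotient.map (fun φ => (⟨φ.1.pushout hγ, φ.2.pushout hγ⟩ : TangibleSVCover (v.coarsen γ)))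
    (fun _ _ h => ⟨SVCover.pushout_mono hγ h.1, SVCover.pushout_mono hγ h.2⟩)

end PushoutCover

/-! ### The t-collapse -/

section Collapse

variable {M U : Type*} [CommSemiring M] [CommSemiring U] [IsSupertropical U]

theorem supertropical_add_congr {x x' y y' : U} (r : U → U → Prop) (hr : ∀ x, r x x)
    (hx : ghostUnit U * x = ghostUnit U * x') (hy : ghostUnit U * y = ghostUnit U * y')
    (h1 : r x x') (h2 : r y y') : r (x + y) (x' + y') := by
  by_cases h : ghostUnit U * x = ghostUnit U * y
  · rw [IsSupertropical.add_eq_ghost x y h, IsSupertropical.add_eq_ghost x' y' (by rw [← hx, h, hy]),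
      hx]
    exact hr _
  · have h' : ghostUnit U * x' ≠ ghostUnit U * y' := by rwa [← hx, ← hy]
    have e1 : ghostUnit U * (x + y) = ghostUnit U * (x' + y') := by
      rw [mul_add, mul_add, hx, hy]
    rcases IsSupertropical.add_eq_or x y h with a | a <;>
      rcases IsSupertropical.add_eq_or x' y' h' with b | b <;> rw [a, b] at e1 ⊢
    · exact h1
    · exact absurd (e1.trans hy.symm) h
    · exact absurd (hx.trans e1.symm) h
    · exact h2

/-- The equivalence relation on `U` whose t-collapse over the ideal `𝔞` of `M` is the quotient:
distinct elements are equivalent iff both are tangible and have the same ghost companion, which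
lies in `𝔞`. -/
def collapseCon (ι : GhostIdent M U) (𝔞 : Ideal M) (hT : TangiblesClosed U) : RingCon U where
  r x y := x = y ∨ (x ∈ tangibles U ∧ y ∈ tangibles U ∧
    ghostUnit U * x = ghostUnit U * y ∧ ι.nu x ∈ 𝔞)
  iseqv := by
    refine ⟨fun x => Or.inl rfl, ?_, ?_⟩
    · rintro x y (rfl | ⟨h1, h2, h3, h4⟩)
      · exact Or.inl rfl
      · exact Or.inr ⟨h2, h1, h3.symm, by rwa [← (ι.nu_eq_iff x y).2 h3]⟩
    · rintro x y z (rfl | ⟨h1, h2, h3, h4⟩) (rfl | ⟨h1', h2', h3', h4'⟩)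
      · exact Or.inl rfl
      · exact Or.inr ⟨h1', h2', h3', h4'⟩
      · exact Or.inr ⟨h1, h2, h3, h4⟩
      · exact Or.inr ⟨h1, h2', h3.trans h3', h4⟩
  mul' := by
    have key : ∀ x y z : U, (x ∈ tangibles U ∧ y ∈ tangibles U ∧
        ghostUnit U * x = ghostUnit U * y ∧ ι.nu x ∈ 𝔞) → (x * z = y * z ∨
        (x * z ∈ tangibles U ∧ y * z ∈ tangibles U ∧
        ghostUnit U * (x * z) = ghostUnit U * (y * z) ∧ ι.nu (x * z) ∈ 𝔞)) := by
      rintro x y z ⟨h1, h2, h3, h4⟩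
      by_cases hz : z ∈ ghostIdeal U
      · left
        rw [← mem_ghostIdeal_iff.1 hz]
        calc x * (ghostUnit U * z) = (ghostUnit U * x) * z := by ring
          _ = (ghostUnit U * y) * z := by rw [h3]
          _ = y * (ghostUnit U * z) := by ring
      · right
        refine ⟨hT x h1 z hz, hT y h2 z hz, by rw [← mul_assoc, h3, mul_assoc], ?_⟩
        rw [ι.nu_mul]
        exact Ideal.mul_mem_right _ _ h4
    rintro w x y z h1 h2
    have s1 : w * y = x * y ∨ (w * y ∈ tangibles U ∧ x * y ∈ tangibles U ∧
        ghostUnit U * (w * y) = ghostUnit U * (x * y) ∧ ι.nu (w * y) ∈ 𝔞) := by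
      rcases h1 with rfl | h1
      · exact Or.inl rfl
      · exact key _ _ _ h1
    have s2 : x * y = x * z ∨ (x * y ∈ tangibles U ∧ x * z ∈ tangibles U ∧
        ghostUnit U * (x * y) = ghostUnit U * (x * z) ∧ ι.nu (x * y) ∈ 𝔞) := by
      rcases h2 with rfl | h2
      · exact Or.inl rfl
      · rw [mul_comm x y, mul_comm x z]
        exact key _ _ _ h2
    rcases s1 with e | ⟨a1, a2, a3, a4⟩
    · rw [e]; exact s2
    · rcases s2 with e | ⟨b1, b2, b3, b4⟩
      · rw [← e]; exact Or.inr ⟨a1, a2, a3, a4⟩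
      · exact Or.inr ⟨a1, b2, a3.trans b3, a4⟩
  add' := by
    intro w x y z h1 h2
    refine supertropical_add_congr (fun x y => x = y ∨ (x ∈ tangibles U ∧ y ∈ tangibles U ∧
      ghostUnit U * x = ghostUnit U * y ∧ ι.nu x ∈ 𝔞)) (fun x => Or.inl rfl) ?_ ?_ h1 h2
    · rcases h1 with rfl | h1
      · rfl
      · exact h1.2.2.1
    · rcases h2 with rfl | h2
      · rfl
      · exact h2.2.2.1

variable (ι : GhostIdent M U) (𝔞 : Ideal M) (hT : TangiblesClosed U)

theorem collapse_ghostUnit_mul (x : U) :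
    ghostUnit (collapseCon ι 𝔞 hT).Quotient * (x : (collapseCon ι 𝔞 hT).Quotient) =
      ((ghostUnit U * x : U) : (collapseCon ι 𝔞 hT).Quotient) := rfl

theorem collapse_ghost_eq {x y : U}
    (h : (x : (collapseCon ι 𝔞 hT).Quotient) = (y : (collapseCon ι 𝔞 hT).Quotient)) :
    ghostUnit U * x = ghostUnit U * y := by
  rcases (RingCon.eq _).1 h with rfl | h
  · rfl
  · exact h.2.2.1

theorem collapse_eq_of_ghost {x y : U} (hx : x ∈ ghostIdeal U)
    (h : (x : (collapseCon ι 𝔞 hT).Quotient) = (y : (collapseCon ι 𝔞 hT).Quotient)) : x = y := by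
  rcases (RingCon.eq _).1 h with rfl | h
  · rfl
  · exact absurd hx h.1

theorem collapse_isSupertropical : IsSupertropical (collapseCon ι 𝔞 hT).Quotient := by
  refine ⟨congrArg (fun x : U => (x : (collapseCon ι 𝔞 hT).Quotient)) IsSupertropical.idem,
    ?_, ?_⟩
  · intro x y
    induction x using Quotient.inductionOn' with
    | h x =>
    induction y using Quotient.inductionOn' with
    | h y =>
    intro h
    have h' : ghostUnit U * x ≠ ghostUnit U * y := fun h' =>
      h (congrArg (fun x : U => (x : (collapseCon ι 𝔞 hT).Quotient)) h')
    exact (IsSupertropical.add_eq_or x y h').imp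
      (congrArg (fun x : U => (x : (collapseCon ι 𝔞 hT).Quotient)))
      (congrArg (fun x : U => (x : (collapseCon ι 𝔞 hT).Quotient)))
  · intro x y
    induction x using Quotient.inductionOn' with
    | h x =>
    induction y using Quotient.inductionOn' with
    | h y =>
    intro h
    have h' := collapse_eq_of_ghost ι 𝔞 hT (ghostUnit_mul_mem x) h
    exact congrArg (fun x : U => (x : (collapseCon ι 𝔞 hT).Quotient))
      (IsSupertropical.add_eq_ghost x y h')

/-- `M` is the ghost ideal of the t-collapse. -/
def collapseGhost : GhostIdent M (collapseCon ι 𝔞 hT).Quotient where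
  toFun m := ((ι m : U) : (collapseCon ι 𝔞 hT).Quotient)
  map_zero' := congrArg (fun x : U => (x : (collapseCon ι 𝔞 hT).Quotient)) ι.map_zero
  map_mul' a b :=
    congrArg (fun x : U => (x : (collapseCon ι 𝔞 hT).Quotient)) (ι.map_mul a b)
  map_add' a b :=
    congrArg (fun x : U => (x : (collapseCon ι 𝔞 hT).Quotient)) (ι.map_add a b)
  map_one' := congrArg (fun x : U => (x : (collapseCon ι 𝔞 hT).Quotient)) ι.map_one
  injective' a b h := ι.injective' (collapse_eq_of_ghost ι 𝔞 hT (ι.mem a) h)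
  range' := by
    haveI := collapse_isSupertropical ι 𝔞 hT
    ext x
    rw [SetLike.mem_coe, mem_ghostIdeal_iff]
    constructor
    · rintro ⟨m, rfl⟩
      exact congrArg (fun x : U => (x : (collapseCon ι 𝔞 hT).Quotient)) (ι.e_mul m)
    · induction x using Quotient.inductionOn' with
      | h x =>
      intro h
      refine ⟨ι.nu x, Eq.trans ?_ h⟩
      exact congrArg (fun x : U => (x : (collapseCon ι 𝔞 hT).Quotient)) (ι.apply_nu x)

end Collapse

section CollapseCover

variable {R : Type u} {M : Type*} [CommSemiring R] [CommSemiring M] {v : MValuation R M}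

/-- The t-collapse of `φ : R → U` over `𝔞`: the composite of `φ` with the t-collapsing map. -/
def SVCover.collapse (φ : SVCover v) (𝔞 : Ideal M) (hT : TangiblesClosed φ.carrier) :
    SVCover v :=
  haveI := collapse_isSupertropical φ.ghost 𝔞 hT
  { carrier := (collapseCon φ.ghost 𝔞 hT).Quotient
    toSV :=
      { toMonoidWithZeroHom :=
          (collapseCon φ.ghost 𝔞 hT).mk'.toMonoidWithZeroHom.comp φ.toSV.toMonoidWithZeroHom
        map_add_le' := fun a b =>
          congrArg (fun x : φ.carrier => (x : (collapseCon φ.ghost 𝔞 hT).Quotient))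
            (φ.toSV.map_add_le' a b) }
    ghost := collapseGhost φ.ghost 𝔞 hT
    covers := fun a =>
      congrArg (fun x : φ.carrier => (x : (collapseCon φ.ghost 𝔞 hT).Quotient)) (φ.covers a)
    surj := fun x => by
      induction x using Quotient.inductionOn' with
      | h x =>
      exact (φ.surj x).imp
        (fun ⟨a, h⟩ => ⟨a, congrArg
          (fun x : φ.carrier => (x : (collapseCon φ.ghost 𝔞 hT).Quotient)) h⟩)
        (fun ⟨a, h⟩ => ⟨a, congrArg
          (fun x : φ.carrier => (x : (collapseCon φ.ghost 𝔞 hT).Quotient)) h⟩) }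

theorem SVCover.IsTangible.collapse {φ : SVCover v} (h : φ.IsTangible) (𝔞 : Ideal M)
    (hT : TangiblesClosed φ.carrier) : (φ.collapse 𝔞 hT).IsTangible := by
  intro a
  haveI := collapse_isSupertropical φ.ghost 𝔞 hT
  refine (h a).imp (fun h1 h2 => h1 ?_)
    (congrArg (fun x : φ.carrier => (x : (collapseCon φ.ghost 𝔞 hT).Quotient)))
  obtain ⟨m, hm⟩ := (collapseGhost φ.ghost 𝔞 hT).exists_of_mem h2
  have := collapse_eq_of_ghost φ.ghost 𝔞 hT (φ.ghost.mem m) hm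
  exact (congrArg (· ∈ ghostIdeal φ.carrier) this).mp (φ.ghost.mem m)

theorem SVCover.collapse_mono {φ ψ : SVCover v} (hψ : ψ.IsTangible) (𝔞 : Ideal M)
    (hT : TangiblesClosed φ.carrier) (hT' : TangiblesClosed ψ.carrier) (h : ψ ≤ φ) :
    ψ.collapse 𝔞 hT' ≤ φ.collapse 𝔞 hT := by
  obtain ⟨α, hα⟩ := h
  haveI := collapse_isSupertropical φ.ghost 𝔞 hT
  haveI := collapse_isSupertropical ψ.ghost 𝔞 hT'
  have hnu : ∀ x, ψ.ghost (φ.ghost.nu x) = ghostUnit _ * α x := by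
    intro x
    rw [← SVCover.transmission_ghost α hα, φ.ghost.apply_nu]
    have := α.map_mul' (ghostUnit _) x
    rw [α.map_ghostUnit'] at this
    exact this
  have hnu' : ∀ x, ψ.ghost.nu (α x) = φ.ghost.nu x := fun x => by
    apply ψ.ghost.injective'
    rw [hnu, ψ.ghost.apply_nu]
  -- a tangible element is a value of `φ`, hence mapped to a tangible element or zero
  have htan : ∀ x ∈ tangibles φ.carrier, α x ∈ tangibles ψ.carrier := by
    intro x hx
    obtain ⟨a, rfl⟩ := φ.exists_of_tangible hx
    have h1 := hψ a
    rw [hα] at h1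
    refine h1.resolve_right fun h2 => hx ?_
    have : φ.toSV a = 0 := φ.ghost.eq_zero_of_nu (by rw [← hnu', h2, ψ.ghost.nu_zero])
    rw [this]
    exact Ideal.zero_mem _
  let f : (collapseCon φ.ghost 𝔞 hT).Quotient → (collapseCon ψ.ghost 𝔞 hT').Quotient :=
    Quotient.map' (fun x => α x) (by
      rintro x y (rfl | ⟨h1, h2, h3, h4⟩)
      · exact Or.inl rfl
      · refine Or.inr ⟨htan _ h1, htan _ h2, ?_, ?_⟩
        · rw [← hnu, ← hnu, (φ.ghost.nu_eq_iff x y).2 h3]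
        · rwa [hnu'])
  let g : (collapseCon φ.ghost 𝔞 hT).Quotient →*₀ (collapseCon ψ.ghost 𝔞 hT').Quotient :=
    { toFun := f
      map_zero' := congrArg
        (fun x : ψ.carrier => (x : (collapseCon ψ.ghost 𝔞 hT').Quotient)) α.map_zero'
      map_one' := congrArg
        (fun x : ψ.carrier => (x : (collapseCon ψ.ghost 𝔞 hT').Quotient)) α.map_one'
      map_mul' := fun x y => by
        induction x using Quotient.inductionOn' with
        | h x =>
        induction y using Quotient.inductionOn' with
        | h y =>
        exact congrArg
          (fun x : ψ.carrier => (x : (collapseCon ψ.ghost 𝔞 hT').Quotient)) (α.map_mul' x y) }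
  refine ⟨Transmission.ofCovers (collapseGhost φ.ghost 𝔞 hT) (collapseGhost ψ.ghost 𝔞 hT')
    (RingHom.id M) g (fun m => congrArg
      (fun x : ψ.carrier => (x : (collapseCon ψ.ghost 𝔞 hT').Quotient))
      (SVCover.transmission_ghost α hα m)), fun a => ?_⟩
  exact congrArg (fun x : ψ.carrier => (x : (collapseCon ψ.ghost 𝔞 hT').Quotient)) (hα a)

/-- The t-collapse over `𝔞`, as a map `Cov_t(v) → Cov_t(v)`. -/
def TCov.collapse [IsCancelMulZero M] (v : MValuation R M) (𝔞 : Ideal M) : TCov v → TCov v :=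
  Quotient.map
    (fun φ => (⟨φ.1.collapse 𝔞 φ.2.tangiblesClosed, φ.2.collapse 𝔞 _⟩ : TangibleSVCover v))
    (fun φ ψ h => ⟨SVCover.collapse_mono φ.2 𝔞 _ _ h.1, SVCover.collapse_mono ψ.2 𝔞 _ _ h.2⟩)

/-- The set of (classes of) tangible supervaluations covering `v` that are t-collapsed
over `𝔞`, i.e. the image of the t-collapse. -/
def tCollapsed [IsCancelMulZero M] (v : MValuation R M) (𝔞 : Ideal M) : Set (TCov v) :=
  Set.range (TCov.collapse v 𝔞)

end CollapseCover

/-! ### Lattices -/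

/-- A poset is a lattice if any two elements have a supremum and an infimum. -/
def IsLatticeOrder (P : Type*) [PartialOrder P] : Prop :=
  ∀ x y : P, (∃ s, IsLUB {x, y} s) ∧ (∃ i, IsGLB {x, y} i)

/-- A subset of a lattice is a sublattice if it contains the supremum and infimum (formed in
the whole lattice) of any two of its elements. -/
def IsSublatticeOf {P : Type*} [PartialOrder P] (S : Set P) : Prop :=
  IsLatticeOrder P ∧
    ∀ x ∈ S, ∀ y ∈ S, ∀ z, (IsLUB {x, y} z → z ∈ S) ∧ (IsGLB {x, y} z → z ∈ S)

/-! ### Semirings determined by a ghost map are supertropical -/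

section OfGhostMapSupertropical

variable {X N : Type*} [CommMonoid X] [CommSemiring N] [IsBipotent N] [IsCancelMulZero N]
  (ν : X →* N) (ι : N → X) (h1 : ∀ n, ν (ι n) = n) (h2 : ∀ n x, ι n * x = ι (n * ν x))
  (h3 : ∀ x, ν x = 0 → x = ι 0)

/-! A tangible supervaluation `φ` covering `v` is determined up to equivalence by its kernel, the
congruence `φ a = φ b` on the multiplicative monoid `R`, and everything is read off from kernels.

Dominance is reverse inclusion of kernels. If the kernel of `φ` lies in that of `ψ`, then `φ a ↦ ψ
a`, together with the identity on ghosts, is a transmission; the two prescriptions are compatible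
because a tangible `φ` takes no ghost value except zero (`SVCover.IsTangible.le_of_kerCon_le`).
Every kernel lies between `v.suppCon` and `v.kerCon`. Conversely each congruence `C` in this
interval is a kernel: adjoin a copy of `M` as ghosts to the nonzero part of `R / C`, and let the
ghost map dictate addition (`SVCover.ofCon`); cancellation in `M` makes this distributive. Hence
`Cov_t(v)` is the order dual of an interval of the lattice `Con R`, and in particular a lattice.

On kernels, the t-collapse over `𝔭` adds the pairs with `v a = v b ∈ 𝔭`, and the pushout adds the
pairs with `v a` and `v b` both in `𝔭`. So being t-collapsed is a lower bound on the kernel, being a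
pushout is an upper bound, and each defines a sublattice. A kernel satisfying the lower bound can be
recovered from its pushout: off `𝔭` the pushout changes nothing, and over `𝔭` such a kernel agrees
with `v a = v b`. Finally, the pairs added by the collapse are among those added by the pushout, so
collapsing first does not change the pushout. This gives surjectivity in (a), and (b) follows with
injectivity. -/

theorem semiringOfGhostMap_ghostUnit :
    @ghostUnit X (semiringOfGhostMap ν ι h1 h2 h3) = ι 1 := by
  change ghostAdd _ _ _ _ = _
  unfold ghostAdd
  rw [if_pos rfl, map_one]

theorem semiringOfGhostMap_ghostUnit_mul (x : X) :
    @ghostUnit X (semiringOfGhostMap ν ι h1 h2 h3) * x = ι (ν x) := by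
  rw [semiringOfGhostMap_ghostUnit, h2, one_mul]

theorem semiringOfGhostMap_isSupertropical :
    @IsSupertropical X (semiringOfGhostMap ν ι h1 h2 h3) := by
  let := semiringOfGhostMap ν ι h1 h2 h3
  have hι : Function.Injective ι := Function.LeftInverse.injective h1
  refine ⟨?_, ?_, ?_⟩
  · rw [semiringOfGhostMap_ghostUnit_mul, semiringOfGhostMap_ghostUnit, h1]
  · intro x y h
    rw [semiringOfGhostMap_ghostUnit_mul, semiringOfGhostMap_ghostUnit_mul] at h
    have h' : ν x ≠ ν y := fun h'' => h (by rw [h''])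
    change ghostAdd _ _ _ _ = _ ∨ ghostAdd _ _ _ _ = _
    unfold ghostAdd
    rw [if_neg h']
    split_ifs
    · exact Or.inr rfl
    · exact Or.inl rfl
  · intro x y h
    rw [semiringOfGhostMap_ghostUnit_mul, semiringOfGhostMap_ghostUnit_mul] at h
    rw [semiringOfGhostMap_ghostUnit_mul]
    change ghostAdd _ _ _ _ = _
    unfold ghostAdd
    rw [if_pos (hι h)]

/-- `N` is the ghost ideal of the semiring determined by a ghost map to `N`. -/
noncomputable def semiringOfGhostMapGhost :
    letI := semiringOfGhostMap ν ι h1 h2 h3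
    GhostIdent N X :=
  letI := semiringOfGhostMap ν ι h1 h2 h3
  { toFun := ι
    map_zero' := rfl
    map_mul' := fun a b => by rw [h2, h1]
    map_add' := fun a b => by
      change _ = ghostAdd _ _ _ _
      unfold ghostAdd
      rw [h1, h1]
      have := IsBipotent.add_eq_or a b
      split_ifs with h h'
      · rcases this with h1 | h1 <;> rw [h1]
        rw [h]
      · rw [h']
      · rw [this.resolve_right h']
    map_one' := (semiringOfGhostMap_ghostUnit ν ι h1 h2 h3).symm
    injective' := Function.LeftInverse.injective h1
    range' := by
      have := semiringOfGhostMap_isSupertropical ν ι h1 h2 h3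
      ext x
      rw [SetLike.mem_coe, mem_ghostIdeal_iff, semiringOfGhostMap_ghostUnit_mul]
      constructor
      · rintro ⟨n, rfl⟩
        exact congrArg _ (h1 n)
      · intro h
        exact ⟨_, h⟩ }

end OfGhostMapSupertropical

/-! ### Kernels of supervaluations -/

section Kernel

variable {R : Type u} {M : Type*} [CommSemiring R] [CommSemiring M] {v : MValuation R M}

theorem MValuation.map_mul (v : MValuation R M) (a b : R) : v (a * b) = v a * v b :=
  v.map_mul' a b

/-- The congruence `v a = v b` on the monoid `R`. -/
def MValuation.kerCon (v : MValuation R M) : Con R where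
  r a b := v a = v b
  iseqv := ⟨fun _ => rfl, fun h => h.symm, fun h h' => h.trans h'⟩
  mul' h h' := by rw [v.map_mul, v.map_mul, h, h']

/-- The congruence on the monoid `R` which contracts the support of `v` to a point. -/
def MValuation.suppCon (v : MValuation R M) : Con R where
  r a b := a = b ∨ (v a = 0 ∧ v b = 0)
  iseqv := by
    refine ⟨fun _ => Or.inl rfl, ?_, ?_⟩
    · rintro a b (rfl | h)
      · exact Or.inl rfl
      · exact Or.inr h.symm
    · rintro a b c (rfl | h) (rfl | h')
      · exact Or.inl rfl
      · exact Or.inr h'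
      · exact Or.inr h
      · exact Or.inr ⟨h.1, h'.2⟩
  mul' := by
    rintro a b c d (rfl | h) (rfl | h')
    · exact Or.inl rfl
    · exact Or.inr (by simp [v.map_mul, h'])
    · exact Or.inr (by simp [v.map_mul, h])
    · exact Or.inr (by simp [v.map_mul, h])

namespace SVCover

theorem map_mul (φ : SVCover v) (a b : R) : φ.toSV (a * b) = φ.toSV a * φ.toSV b :=
  φ.toSV.map_mul' a b

theorem toSV_eq_zero_iff (φ : SVCover v) (a : R) : φ.toSV a = 0 ↔ v a = 0 := by
  rw [← φ.nu_toSV]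
  exact ⟨fun h => by rw [h, φ.ghost.nu_zero], φ.ghost.eq_zero_of_nu⟩

theorem IsTangible.eq_zero_of_mem {φ : SVCover v} (h : φ.IsTangible) {a : R}
    (ha : φ.toSV a ∈ ghostIdeal φ.carrier) : v a = 0 :=
  (φ.toSV_eq_zero_iff a).1 ((h a).resolve_left fun h' => h' ha)

theorem eq_toSV_or_ghost (φ : SVCover v) (x : φ.carrier) :
    (∃ a, x = φ.toSV a) ∨ ∃ m, x = φ.ghost m :=
  (φ.surj x).imp id fun ⟨a, h⟩ => ⟨v a, by rw [h, φ.covers]⟩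

/-- The kernel `φ a = φ b` of a supervaluation, a congruence on the monoid `R`. -/
def kerCon (φ : SVCover v) : Con R where
  r a b := φ.toSV a = φ.toSV b
  iseqv := ⟨fun _ => rfl, fun h => h.symm, fun h h' => h.trans h'⟩
  mul' h h' := by rw [φ.map_mul, φ.map_mul, h, h']

theorem kerCon_iff (φ : SVCover v) {a b : R} : φ.kerCon a b ↔ φ.toSV a = φ.toSV b := Iff.rfl

theorem kerCon_le_of_le {φ ψ : SVCover v} (h : ψ ≤ φ) : φ.kerCon ≤ ψ.kerCon := by
  obtain ⟨α, hα⟩ := h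
  intro a b hab
  rw [kerCon_iff] at hab ⊢
  rw [hα, hα, hab]

theorem kerCon_le (φ : SVCover v) : φ.kerCon ≤ v.kerCon := by
  intro a b hab
  change v a = v b
  rw [← φ.nu_toSV, ← φ.nu_toSV, φ.kerCon_iff.1 hab]

/-- In a supertropical semiring `e x = 0` forces `x = 0`, so `φ` vanishes on the whole support of
`v`. -/
theorem suppCon_le_kerCon (φ : SVCover v) : v.suppCon ≤ φ.kerCon := by
  rintro a b (rfl | ⟨h, h'⟩)
  · exact φ.kerCon.refl _
  · rw [kerCon_iff, (φ.toSV_eq_zero_iff a).2 h, (φ.toSV_eq_zero_iff b).2 h']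

/-- A tangible supervaluation dominates every supervaluation with a larger kernel. -/
theorem IsTangible.le_of_kerCon_le {φ ψ : SVCover v} (hφ : φ.IsTangible)
    (h : φ.kerCon ≤ ψ.kerCon) : ψ ≤ φ := by
  classical
  -- Elements that are not values of `φ` are ghosts, so the second branch only has to carry each
  -- ghost to the same element of `M`.
  let f : φ.carrier → ψ.carrier := fun x =>
    if hx : ∃ a, x = φ.toSV a then ψ.toSV hx.choose else ψ.ghost (φ.ghost.nu x)
  have f_toSV : ∀ a, f (φ.toSV a) = ψ.toSV a := by
    intro a
    have hx : ∃ b, φ.toSV a = φ.toSV b := ⟨a, rfl⟩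
    have hf : f (φ.toSV a) = ψ.toSV hx.choose := dif_pos hx
    rw [hf]
    exact (h hx.choose_spec).symm
  have f_ghost : ∀ m, f (φ.ghost m) = ψ.ghost m := by
    intro m
    -- The branches can only conflict at a ghost that is a value of `φ`; by tangibility this is
    -- zero, where both give zero.
    by_cases hx : ∃ a, φ.ghost m = φ.toSV a
    · obtain ⟨a, ha⟩ := hx
      have h0 : v a = 0 := hφ.eq_zero_of_mem (ha ▸ φ.ghost.mem m)
      have hm : m = 0 := by rw [← φ.ghost.nu_apply m, ha, φ.nu_toSV, h0]
      rw [ha, f_toSV, (ψ.toSV_eq_zero_iff a).2 h0, hm, ψ.ghost.map_zero]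
    · exact (dif_neg hx).trans (by rw [φ.ghost.nu_apply])
  have nu_f : ∀ x, ψ.ghost.nu (f x) = φ.ghost.nu x := by
    intro x
    rcases φ.eq_toSV_or_ghost x with ⟨a, rfl⟩ | ⟨m, rfl⟩
    · rw [f_toSV, ψ.nu_toSV, φ.nu_toSV]
    · rw [f_ghost, ψ.ghost.nu_apply, φ.ghost.nu_apply]
  -- A product with a ghost factor depends only on the ghost companion of the other factor, and `f`
  -- preserves companions.
  have f_ghost_mul : ∀ m x, f (φ.ghost m * x) = f (φ.ghost m) * f x := fun m x => by
    rw [φ.ghost.ghost_mul, f_ghost, f_ghost, ψ.ghost.ghost_mul, nu_f]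
  let g : φ.carrier →*₀ ψ.carrier :=
    { toFun := f
      map_zero' := by rw [← φ.ghost.map_zero, f_ghost, ψ.ghost.map_zero]
      map_one' := by
        have e1 : φ.toSV 1 = 1 := φ.toSV.map_one'
        have e2 : ψ.toSV 1 = 1 := ψ.toSV.map_one'
        rw [← e1, f_toSV, e2]
      map_mul' := fun x y => by
        rcases φ.eq_toSV_or_ghost x with ⟨a, rfl⟩ | ⟨m, rfl⟩
        · rcases φ.eq_toSV_or_ghost y with ⟨b, rfl⟩ | ⟨n, rfl⟩
          · rw [← φ.map_mul, f_toSV, f_toSV, f_toSV, ψ.map_mul]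
          · rw [mul_comm, f_ghost_mul, mul_comm]
        · exact f_ghost_mul m y }
  exact ⟨Transmission.ofCovers φ.ghost ψ.ghost (RingHom.id M) g f_ghost,
    fun a => (f_toSV a).symm⟩

end SVCover

/-! ### The tangible supervaluation with a given kernel -/

/-- The congruence on `R × ℕ` whose quotient is the disjoint union of `(R / C) ∖ {0}`, as the set of
classes of pairs `(a, s)` with `s ≠ 0`, and of `v(R)`, as the set of classes of pairs `(a, 0)`. -/
def ghostExtensionCon (v : MValuation R M) (C : Con R) : Con (R × ℕ) where
  r x y := v x.1 = v y.1 ∧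
    -- Only whether the second coordinate vanishes matters: zero marks a ghost. Since `ℕ` has no
    -- zero divisors, a product is marked ghost exactly when a factor is. The clause `v x.1 = 0`
    -- merges everything over zero into one class.
    (v x.1 = 0 ∨ (x.2 = 0 ∧ y.2 = 0) ∨ (x.2 ≠ 0 ∧ y.2 ≠ 0 ∧ C x.1 y.1))
  iseqv := by
    refine ⟨fun x => ⟨rfl, ?_⟩, ?_, ?_⟩
    · by_cases h : x.2 = 0
      · exact Or.inr (Or.inl ⟨h, h⟩)
      · exact Or.inr (Or.inr ⟨h, h, C.refl _⟩)
    · rintro x y ⟨h, h' | h' | ⟨h1, h2, h3⟩⟩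
      · exact ⟨h.symm, Or.inl (h ▸ h')⟩
      · exact ⟨h.symm, Or.inr (Or.inl h'.symm)⟩
      · exact ⟨h.symm, Or.inr (Or.inr ⟨h2, h1, C.symm h3⟩)⟩
    · rintro x y z ⟨h, h'⟩ ⟨k, k'⟩
      refine ⟨h.trans k, ?_⟩
      rcases h' with h' | h' | ⟨h1, h2, h3⟩
      · exact Or.inl h'
      · rcases k' with k' | k' | k'
        · exact Or.inl (h.trans k')
        · exact Or.inr (Or.inl ⟨h'.1, k'.2⟩)
        · exact absurd h'.2 k'.1
      · rcases k' with k' | k' | k'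
        · exact Or.inl (h.trans k')
        · exact absurd k'.1 h2
        · exact Or.inr (Or.inr ⟨h1, k'.2.1, C.trans h3 k'.2.2⟩)
  mul' := by
    rintro w x y z ⟨h, h'⟩ ⟨k, k'⟩
    simp only [Prod.fst_mul, Prod.snd_mul, v.map_mul]
    refine ⟨by rw [h, k], ?_⟩
    rcases h' with h' | h' | ⟨h1, h2, h3⟩
    · exact Or.inl (by rw [h', zero_mul])
    · exact Or.inr (Or.inl (by simp [h']))
    · rcases k' with k' | k' | k'
      · exact Or.inl (by rw [k', mul_zero])
      · exact Or.inr (Or.inl (by simp [k']))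
      · exact Or.inr (Or.inr ⟨mul_ne_zero h1 k'.1, mul_ne_zero h2 k'.2.1, C.mul h3 k'.2.2⟩)

/-- The ghost map of the quotient by `ghostExtensionCon`. -/
def ghostExtensionNu (v : MValuation R M) (C : Con R) : (ghostExtensionCon v C).Quotient →* M :=
  (ghostExtensionCon v C).lift
    ((v.toMonoidWithZeroHom : R →* M).comp (MonoidHom.fst R ℕ)) (fun _ _ h => h.1)

theorem ghostExtensionNu_coe (v : MValuation R M) (C : Con R) (x : R × ℕ) :
    ghostExtensionNu v C (x : (ghostExtensionCon v C).Quotient) = v x.1 := rfl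

/-- The inclusion of the ghosts in the quotient by `ghostExtensionCon`. -/
noncomputable def ghostExtensionIota (C : Con R) (hv : Function.Surjective v) (m : M) :
    (ghostExtensionCon v C).Quotient :=
  ((Function.surjInv hv m, 0) : R × ℕ)

theorem ghostExtensionIota_map (C : Con R) (hv : Function.Surjective v) (a : R) :
    ghostExtensionIota C hv (v a) = ((a, 0) : R × ℕ) :=
  (Con.eq _).2 ⟨Function.surjInv_eq hv _, Or.inr (Or.inl ⟨rfl, rfl⟩)⟩

theorem ghostExtensionNu_iota (C : Con R) (hv : Function.Surjective v) (m : M) :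
    ghostExtensionNu v C (ghostExtensionIota C hv m) = m :=
  Function.surjInv_eq hv m

theorem ghostExtensionIota_mul (C : Con R) (hv : Function.Surjective v) (m : M)
    (x : (ghostExtensionCon v C).Quotient) :
    ghostExtensionIota C hv m * x = ghostExtensionIota C hv (m * ghostExtensionNu v C x) := by
  obtain ⟨a, rfl⟩ := hv m
  induction x using Con.induction_on with
  | H x =>
    rw [ghostExtensionNu_coe, ← v.map_mul, ghostExtensionIota_map, ghostExtensionIota_map,
      ← Con.coe_mul]
    exact congrArg _ (Prod.ext rfl (zero_mul x.2))

theorem ghostExtensionNu_eq_zero (C : Con R) (hv : Function.Surjective v)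
    (x : (ghostExtensionCon v C).Quotient) (h : ghostExtensionNu v C x = 0) :
    x = ghostExtensionIota C hv 0 := by
  induction x using Con.induction_on with
  | H x =>
    exact (Con.eq _).2 ⟨h.trans (Function.surjInv_eq hv 0).symm, Or.inl h⟩

variable [IsBipotent M] [IsCancelMulZero M]

/-- The supervaluation covering `v` obtained from a congruence `C` on `R`. If `C` lies between
`v.suppCon` and `v.kerCon`, its kernel is `C`. -/
noncomputable def SVCover.ofCon (C : Con R) (hv : Function.Surjective v) : SVCover v :=
  letI := semiringOfGhostMap (ghostExtensionNu v C) (ghostExtensionIota C hv)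
    (ghostExtensionNu_iota C hv) (ghostExtensionIota_mul C hv) (ghostExtensionNu_eq_zero C hv)
  haveI := semiringOfGhostMap_isSupertropical (ghostExtensionNu v C) (ghostExtensionIota C hv)
    (ghostExtensionNu_iota C hv) (ghostExtensionIota_mul C hv) (ghostExtensionNu_eq_zero C hv)
  have hcov : ∀ a, ghostExtensionIota C hv (v a) =
      ghostUnit _ * (((a, 1) : R × ℕ) : (ghostExtensionCon v C).Quotient) := fun a =>
    (semiringOfGhostMap_ghostUnit_mul (ghostExtensionNu v C) (ghostExtensionIota C hv)
      (ghostExtensionNu_iota C hv) (ghostExtensionIota_mul C hv)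
      (ghostExtensionNu_eq_zero C hv)
      (((a, 1) : R × ℕ) : (ghostExtensionCon v C).Quotient)).symm
  let κ := semiringOfGhostMapGhost (ghostExtensionNu v C) (ghostExtensionIota C hv)
    (ghostExtensionNu_iota C hv) (ghostExtensionIota_mul C hv) (ghostExtensionNu_eq_zero C hv)
  { carrier := (ghostExtensionCon v C).Quotient
    toSV :=
      { toFun := fun a => ((a, 1) : R × ℕ)
        map_zero' := ghostExtensionNu_eq_zero C hv _ v.map_zero'
        map_one' := rfl
        map_mul' := fun _ _ => rfl
        map_add_le' := fun a b => by
          rw [← hcov, ← hcov, ← hcov]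
          change κ _ + (κ _ + κ _) = κ _ + κ _
          rw [← κ.map_add, ← κ.map_add]
          exact congrArg _ (v.map_add_le' a b) }
    ghost := κ
    covers := hcov
    surj := fun x => by
      induction x using Con.induction_on with
      | H x =>
        obtain ⟨a, s⟩ := x
        by_cases hs : s = 0
        · refine Or.inr ⟨a, Eq.trans ?_ (hcov a)⟩
          rw [ghostExtensionIota_map, hs]
        -- All nonzero markers are equivalent, so `(a, s)` and `(a, 1)` have the same class.
        · exact Or.inl ⟨a, (Con.eq _).2 ⟨rfl, Or.inr (Or.inr ⟨hs, one_ne_zero, C.refl a⟩)⟩⟩ }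

/-- Markers `1` and `0` are never identified except over `v a = 0`, and there the value is zero. -/
theorem SVCover.ofCon_isTangible (C : Con R) (hv : Function.Surjective v) :
    (SVCover.ofCon C hv).IsTangible := by
  intro a
  by_cases h0 : v a = 0
  · exact Or.inr (((ofCon C hv).toSV_eq_zero_iff a).2 h0)
  · left
    intro hmem
    obtain ⟨m, hm⟩ := (ofCon C hv).ghost.exists_of_mem hmem
    have hm' : (((a, 1) : R × ℕ) : (ghostExtensionCon v C).Quotient) =
      ((Function.surjInv hv m, 0) : R × ℕ) := hm.symm
    rcases ((Con.eq _).1 hm').2 with h | h | h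
    · exact h0 h
    · exact one_ne_zero h.1
    · exact h.2.1 rfl

/-- The construction forces two things beyond `C`: equivalent elements have the same value under
`v`, and the support of `v` is contracted. The two bounds say that `C` already complies. -/
theorem SVCover.kerCon_ofCon {C : Con R} (hv : Function.Surjective v) (h1 : v.suppCon ≤ C)
    (h2 : C ≤ v.kerCon) : (SVCover.ofCon C hv).kerCon = C := by
  ext a b
  have hiff : (SVCover.ofCon C hv).kerCon a b ↔ ghostExtensionCon v C (a, 1) (b, 1) := Con.eq _
  refine hiff.trans ⟨?_, fun h => ⟨h2 h, Or.inr (Or.inr ⟨one_ne_zero, one_ne_zero, h⟩)⟩⟩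
  rintro ⟨h, h' | h' | h'⟩
  · exact h1 (Or.inr ⟨h', h.symm.trans h'⟩)
  · exact absurd h'.1 one_ne_zero
  · exact h'.2.2

end Kernel

/-! ### The order of `Cov_t(v)` in terms of kernels -/

namespace TCov

variable {R : Type u} {M N : Type*} [CommSemiring R] [CommSemiring M] [CommSemiring N]
  {v : MValuation R M}

/-- The kernel of a class of tangible supervaluations. -/
def kerCon : TCov v → Con R :=
  Quotient.lift (fun φ : TangibleSVCover v => φ.1.kerCon) fun _ _ h =>
    le_antisymm (SVCover.kerCon_le_of_le h.2) (SVCover.kerCon_le_of_le h.1)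

/-- Makes `kerCon` an order-reversing embedding into `Con R`, so that statements about dominance
become statements about congruences. -/
theorem kerCon_le_iff (x y : TCov v) : x.kerCon ≤ y.kerCon ↔ y ≤ x := by
  induction x using Quotient.inductionOn with
  | h φ =>
  induction y using Quotient.inductionOn with
  | h ψ => exact ⟨φ.2.le_of_kerCon_le, SVCover.kerCon_le_of_le⟩

theorem kerCon_injective : Function.Injective (kerCon (v := v)) := fun x y h =>
  le_antisymm ((kerCon_le_iff y x).1 h.ge) ((kerCon_le_iff x y).1 h.le)

theorem kerCon_le (x : TCov v) : x.kerCon ≤ v.kerCon := by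
  induction x using Quotient.inductionOn with
  | h φ => exact φ.1.kerCon_le

theorem suppCon_le_kerCon (x : TCov v) : v.suppCon ≤ x.kerCon := by
  induction x using Quotient.inductionOn with
  | h φ => exact φ.1.suppCon_le_kerCon

/-- Identifies the image of the embedding `kerCon` as the full interval from `v.suppCon` to
`v.kerCon`. -/
theorem exists_kerCon_eq [IsBipotent M] [IsCancelMulZero M] (hv : Function.Surjective v)
    {C : Con R} (h1 : v.suppCon ≤ C) (h2 : C ≤ v.kerCon) : ∃ x : TCov v, x.kerCon = C :=
  ⟨toAntisymmetrization _ ⟨SVCover.ofCon C hv, SVCover.ofCon_isTangible C hv⟩,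
    SVCover.kerCon_ofCon hv h1 h2⟩

/-! ### Suprema and infima in `Cov_t(v)` -/

section Lattice

variable [IsBipotent M] [IsCancelMulZero M]

/-- The order is reversed, so suprema come from meets of kernels and, in `exists_isGLB`, infima from
joins. The formula for the kernel is kept because membership in the sublattices is tested on
kernels. -/
theorem exists_isLUB (hv : Function.Surjective v) (x y : TCov v) :
    ∃ s : TCov v, IsLUB {x, y} s ∧ s.kerCon = x.kerCon ⊓ y.kerCon := by
  obtain ⟨s, hs⟩ := exists_kerCon_eq hv (le_inf x.suppCon_le_kerCon y.suppCon_le_kerCon)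
    (inf_le_left.trans x.kerCon_le)
  refine ⟨s, ⟨?_, fun z hz => ?_⟩, hs⟩
  · rintro z (rfl | rfl) <;> rw [← kerCon_le_iff, hs]
    exacts [inf_le_left, inf_le_right]
  · rw [← kerCon_le_iff, hs]
    exact le_inf ((kerCon_le_iff _ _).2 (hz (Or.inl rfl))) ((kerCon_le_iff _ _).2 (hz (Or.inr rfl)))

theorem exists_isGLB (hv : Function.Surjective v) (x y : TCov v) :
    ∃ i : TCov v, IsGLB {x, y} i ∧ i.kerCon = x.kerCon ⊔ y.kerCon := by
  obtain ⟨i, hi⟩ := exists_kerCon_eq hv (x.suppCon_le_kerCon.trans le_sup_left)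
    (sup_le x.kerCon_le y.kerCon_le)
  refine ⟨i, ⟨?_, fun z hz => ?_⟩, hi⟩
  · rintro z (rfl | rfl) <;> rw [← kerCon_le_iff, hi]
    exacts [le_sup_left, le_sup_right]
  · rw [← kerCon_le_iff, hi]
    exact sup_le ((kerCon_le_iff _ _).2 (hz (Or.inl rfl))) ((kerCon_le_iff _ _).2 (hz (Or.inr rfl)))

theorem isLatticeOrder (hv : Function.Surjective v) : IsLatticeOrder (TCov v) := fun x y =>
  ⟨(exists_isLUB hv x y).imp fun _ h => h.1, (exists_isGLB hv x y).imp fun _ h => h.1⟩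

/-- The classes with kernel in a given interval form a sublattice of `Cov_t(v)`. -/
theorem isSublatticeOf_kerCon_mem_Icc (hv : Function.Surjective v) (C D : Con R) :
    IsSublatticeOf {x : TCov v | x.kerCon ∈ Set.Icc C D} := by
  refine ⟨isLatticeOrder hv, fun x hx y hy z => ⟨fun hz => ?_, fun hz => ?_⟩⟩
  · obtain ⟨s, hs, h⟩ := exists_isLUB hv x y
    rw [hz.unique hs, Set.mem_ofPred_eq, h]
    exact ⟨le_inf hx.1 hy.1, inf_le_left.trans hx.2⟩
  · obtain ⟨i, hi, h⟩ := exists_isGLB hv x y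
    rw [hz.unique hi, Set.mem_ofPred_eq, h]
    exact ⟨hx.1.trans le_sup_left, sup_le hx.2 hy.2⟩

end Lattice

/-! ### Kernels of pushouts and t-collapses -/

/-- The tangibility condition of the collapsing congruence disappears: a value of `φ` is tangible
unless `v` vanishes there, and then both values are zero and already equal. -/
theorem kerCon_collapse_iff [IsCancelMulZero M] (𝔞 : Ideal M) (x : TCov v) (a b : R) :
    (TCov.collapse v 𝔞 x).kerCon a b ↔ x.kerCon a b ∨ (v a = v b ∧ v a ∈ 𝔞) := by
  induction x using Quotient.inductionOn with
  | h φ =>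
  obtain ⟨φ, hφ⟩ := φ
  have hiff : ∀ a, φ.toSV a ∈ tangibles φ.carrier ∨ v a = 0 := fun a =>
    (hφ a).imp_right (φ.toSV_eq_zero_iff a).1
  change ((φ.toSV a : φ.carrier) : (collapseCon φ.ghost 𝔞 _).Quotient) = φ.toSV b ↔
    φ.toSV a = φ.toSV b ∨ _
  refine (RingCon.eq _).trans ?_
  change _ ∨ _ ↔ _
  rw [← φ.ghost.nu_eq_iff, φ.nu_toSV, φ.nu_toSV]
  constructor
  · exact Or.imp_right fun h => ⟨h.2.2.1, h.2.2.2⟩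
  · rintro (h | ⟨h, h'⟩)
    · exact Or.inl h
    · by_cases h0 : v a = 0
      · left
        rw [(φ.toSV_eq_zero_iff a).2 h0, (φ.toSV_eq_zero_iff b).2 (h.symm.trans h0)]
      · exact Or.inr ⟨(hiff a).resolve_right h0, (hiff b).resolve_right (h ▸ h0), h, h'⟩

variable [IsBipotent N] [IsCancelMulZero N] {γ : M →+* N}

/-- The clause of `E(U, γ)` about ghosts adds nothing: a tangible supervaluation has no ghost value
but zero, which the last clause covers. -/
theorem kerCon_pushout_iff (hγ : Function.Surjective γ) (x : TCov v) (a b : R) :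
    (TCov.pushout v hγ x).kerCon a b ↔ x.kerCon a b ∨ (γ (v a) = 0 ∧ γ (v b) = 0) := by
  induction x using Quotient.inductionOn with
  | h φ =>
  obtain ⟨φ, hφ⟩ := φ
  change ((φ.toSV a : φ.carrier) : PushoutCarrier φ.ghost γ) = φ.toSV b ↔
    φ.toSV a = φ.toSV b ∨ _
  refine (Con.eq _).trans ?_
  change _ ∨ _ ∨ _ ↔ _
  rw [φ.nu_toSV, φ.nu_toSV]
  constructor
  · rintro (h | ⟨m, n, h, h', -⟩ | h)
    · exact Or.inl h
    · right
      rw [hφ.eq_zero_of_mem (h ▸ φ.ghost.mem m), hφ.eq_zero_of_mem (h' ▸ φ.ghost.mem n), map_zero]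
      exact ⟨rfl, rfl⟩
    · exact Or.inr h
  · exact Or.imp_right Or.inr

/-- The congruence on the monoid `R` for which distinct elements are equivalent iff they have the
same value under `v`, which lies in `𝔞`. -/
def _root_.MValuation.collapseKerCon (v : MValuation R M) (𝔞 : Ideal M) : Con R where
  r a b := a = b ∨ (v a = v b ∧ v a ∈ 𝔞)
  iseqv := by
    refine ⟨fun _ => Or.inl rfl, ?_, ?_⟩
    · rintro a b (rfl | h)
      · exact Or.inl rfl
      · exact Or.inr ⟨h.1.symm, h.1 ▸ h.2⟩
    · rintro a b c (rfl | h) (rfl | h')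
      · exact Or.inl rfl
      · exact Or.inr h'
      · exact Or.inr h
      · exact Or.inr ⟨h.1.trans h'.1, h.2⟩
  mul' := by
    rintro a b c d (rfl | h) (rfl | h')
    · exact Or.inl rfl
    · exact Or.inr (by
        rw [v.map_mul, v.map_mul, h'.1]; exact ⟨rfl, 𝔞.mul_mem_left _ (h'.1 ▸ h'.2)⟩)
    · exact Or.inr (by
        rw [v.map_mul, v.map_mul, h.1]; exact ⟨rfl, 𝔞.mul_mem_right _ (h.1 ▸ h.2)⟩)
    · exact Or.inr (by
        rw [v.map_mul, v.map_mul, h.1, h'.1]; exact ⟨rfl, 𝔞.mul_mem_right _ (h.1 ▸ h.2)⟩)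

/-! ### T-collapsed classes and pushouts as intervals of kernels -/

/-- A class whose kernel already contains the pairs added by the collapse is its own t-collapse. -/
theorem mem_tCollapsed_iff [IsCancelMulZero M] (𝔞 : Ideal M) (x : TCov v) :
    x ∈ tCollapsed v 𝔞 ↔ v.collapseKerCon 𝔞 ≤ x.kerCon := by
  constructor
  · rintro ⟨y, rfl⟩ a b (rfl | h)
    · exact Con.refl _ _
    · exact (kerCon_collapse_iff 𝔞 y a b).2 (Or.inr h)
  · intro h
    refine ⟨x, kerCon_injective (Con.ext fun a b => ?_)⟩
    rw [kerCon_collapse_iff]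
    exact or_iff_left_of_imp fun h' => h (Or.inr h')

/-- A pushout identifies elements only when they have the same value under `v` or both lie over `𝔭`.
Conversely, a kernel with this property is recovered from its pairs of the first kind by adding all
pairs of the second. -/
theorem mem_range_pushout_iff [IsBipotent M] [IsCancelMulZero M] (hv : Function.Surjective v)
    (hγ : Function.Surjective γ) (y : TCov (v.coarsen γ)) :
    y ∈ Set.range (TCov.pushout v hγ) ↔ y.kerCon ≤ v.kerCon ⊔ (v.coarsen γ).suppCon := by
  -- The join is a mere union of relations. Instead of following chains, it is bounded by the kernel
  -- of the pushout of the least tangible class, whose kernel is `v.kerCon`.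
  have hsup : ∀ a b, (v.kerCon ⊔ (v.coarsen γ).suppCon) a b →
      v a = v b ∨ (γ (v a) = 0 ∧ γ (v b) = 0) := by
    obtain ⟨x, hx⟩ := exists_kerCon_eq hv
      (show v.suppCon ≤ v.kerCon by
        rintro a b (rfl | h)
        · exact Con.refl _ _
        · exact h.1.trans h.2.symm) le_rfl
    intro a b h
    have hle : v.kerCon ⊔ (v.coarsen γ).suppCon ≤ (TCov.pushout v hγ x).kerCon := by
      refine sup_le (fun c d hcd => ?_) (suppCon_le_kerCon _)
      rw [kerCon_pushout_iff, hx]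
      exact Or.inl hcd
    have := (kerCon_pushout_iff hγ x a b).1 (hle h)
    rwa [hx] at this
  constructor
  · rintro ⟨x, rfl⟩ a b h
    rcases (kerCon_pushout_iff hγ x a b).1 h with h | h
    · exact (le_sup_left : v.kerCon ≤ _) (x.kerCon_le h)
    · exact (le_sup_right : (v.coarsen γ).suppCon ≤ _) (Or.inr h)
  · intro h
    -- The preimage keeps exactly the identifications of `y` that are compatible with `v`.
    obtain ⟨x, hx⟩ := exists_kerCon_eq (v := v) (C := y.kerCon ⊓ v.kerCon) hv
      (by
        rintro a b (rfl | h)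
        · exact Con.refl _ _
        · refine ⟨y.suppCon_le_kerCon (Or.inr ⟨?_, ?_⟩), h.1.trans h.2.symm⟩
          · change γ (v a) = 0
            rw [h.1, map_zero]
          · change γ (v b) = 0
            rw [h.2, map_zero])
      inf_le_right
    refine ⟨x, kerCon_injective (Con.ext fun a b => ?_)⟩
    rw [kerCon_pushout_iff, hx]
    constructor
    · rintro (h' | h')
      · exact h'.1
      · exact y.suppCon_le_kerCon (Or.inr h')
    · exact fun h' => (hsup a b (h h')).imp_left fun h'' => ⟨h', h''⟩

/-- On t-collapsed supervaluations the pushout map is an order embedding. -/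
theorem pushout_le_pushout_iff [IsCancelMulZero M] (hγ : Function.Surjective γ) {x y : TCov v}
    (hy : y ∈ tCollapsed v (RingHom.ker γ)) :
    TCov.pushout v hγ y ≤ TCov.pushout v hγ x ↔ y ≤ x := by
  rw [mem_tCollapsed_iff] at hy
  rw [← kerCon_le_iff, ← kerCon_le_iff]
  constructor
  · intro h a b hab
    rcases (kerCon_pushout_iff hγ y a b).1
      (h ((kerCon_pushout_iff hγ x a b).2 (Or.inl hab))) with h' | h'
    · exact h'
    -- A pair added by the pushout has both values in `𝔭`; being in the kernel of `x` it also has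
    -- equal values, and the t-collapsed `y` identifies all such pairs.
    · exact hy (Or.inr ⟨x.kerCon_le hab, h'.1⟩)
  · intro h a b hab
    rw [kerCon_pushout_iff] at hab ⊢
    exact hab.imp_left fun h' => h h'

/-- What the collapse identifies lies over `𝔭`, and the pushout contracts all of that to zero
anyway. -/
theorem pushout_collapse [IsCancelMulZero M] (hγ : Function.Surjective γ) (x : TCov v) :
    TCov.pushout v hγ (TCov.collapse v (RingHom.ker γ) x) = TCov.pushout v hγ x := by
  refine kerCon_injective (Con.ext fun a b => ?_)
  rw [kerCon_pushout_iff, kerCon_pushout_iff, kerCon_collapse_iff, or_assoc]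
  refine or_congr_right (or_iff_right_of_imp fun h => ?_)
  exact ⟨h.2, h.1 ▸ h.2⟩

theorem pushout_injOn [IsCancelMulZero M] (hγ : Function.Surjective γ) :
    Set.InjOn (TCov.pushout v hγ) (tCollapsed v (RingHom.ker γ)) := fun _ hx _ hy h =>
  le_antisymm ((pushout_le_pushout_iff hγ hx).1 h.le) ((pushout_le_pushout_iff hγ hy).1 h.ge)

theorem pushout_bijOn [IsCancelMulZero M] (hγ : Function.Surjective γ) :
    Set.BijOn (TCov.pushout v hγ) (tCollapsed v (RingHom.ker γ))
      (Set.range (TCov.pushout v hγ)) := by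
  refine ⟨fun x _ => ⟨x, rfl⟩, pushout_injOn hγ, ?_⟩
  rintro _ ⟨x, rfl⟩
  exact ⟨_, ⟨x, rfl⟩, pushout_collapse hγ x⟩

end TCov

theorem theorem2p14 {R : Type u} {M N : Type*} [CommSemiring R]
    [CommSemiring M] [IsBipotent M] [IsCancelMulZero M]
    [CommSemiring N] [IsBipotent N] [IsCancelMulZero N]
    (v : MValuation R M) (hv : Function.Surjective v)
    (γ : M →+* N) (hγ : Function.Surjective γ) :
    Set.BijOn (TCov.pushout v hγ) (tCollapsed v (RingHom.ker γ))
        (Set.range (TCov.pushout v hγ)) ∧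
      IsSublatticeOf (tCollapsed v (RingHom.ker γ)) ∧
      IsSublatticeOf (Set.range (TCov.pushout v hγ)) ∧
      (∃ f : tCollapsed v (RingHom.ker γ) ≃o Set.range (TCov.pushout v hγ),
        ∀ c, (f c : TCov (v.coarsen γ)) = TCov.pushout v hγ c) ∧
      (∀ φ ψ : TCov v, TCov.pushout v hγ φ = TCov.pushout v hγ ψ ↔
        TCov.collapse v (RingHom.ker γ) φ = TCov.collapse v (RingHom.ker γ) ψ) := by
  refine ⟨TCov.pushout_bijOn hγ, ?_, ?_, ⟨⟨(TCov.pushout_bijOn hγ).equiv, ?_⟩, fun _ => rfl⟩,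
    fun φ ψ => ⟨fun h => ?_, fun h => ?_⟩⟩
  -- Only one end of each interval is a condition; `⊤` here and `⊥` below are vacuous bounds.
  · convert TCov.isSublatticeOf_kerCon_mem_Icc hv (v.collapseKerCon (RingHom.ker γ)) ⊤ using 1
    ext x
    rw [TCov.mem_tCollapsed_iff]
    exact (and_iff_left le_top).symm
  · convert TCov.isSublatticeOf_kerCon_mem_Icc (v := v.coarsen γ) (hγ.comp hv) ⊥
      (v.kerCon ⊔ (v.coarsen γ).suppCon) using 1
    ext y
    rw [TCov.mem_range_pushout_iff hv]
    exact (and_iff_right bot_le).symm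
  · exact fun {x y} => TCov.pushout_le_pushout_iff hγ x.2
  -- The two t-collapses have the same pushouts as `φ` and `ψ`, and the pushout is injective on
  -- t-collapsed classes.
  · refine TCov.pushout_injOn hγ ⟨φ, rfl⟩ ⟨ψ, rfl⟩ ?_
    rw [TCov.pushout_collapse, TCov.pushout_collapse, h]
  · rw [← TCov.pushout_collapse, h, TCov.pushout_collapse]
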